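/- Conventions. Manifolds are Hausdorff and second countable. Let $(N,J)$ be a complex manifold. A Hermitian metric on $N$ is a smooth Riemannian metric $g$ with $g(JX,JY)=g(X,Y)$; its fundamental form is $\Omega(X,Y)=g(JX,Y)$, and $g$ is Kähler if $d\Omega=0$. The conformal class $[g]$ consists of the metrics $e^{\alpha}g$ with $\alpha\in C^\infty(N)$. Assume $\dim_{\mathbb C}N\ge 2$. Then $[g]$ (or $(N,[g],J)$) is locally conformal Kähler if every point of $N$ has an open neighbourhood $U$ with a smooth function $\alpha$ on $U$ such that $e^{\alpha}g|_U$ is Kähler, and globally conformal Kähler if $[g]$ contains a Kähler metric. An automorphism of $(N,[g],J)$ is a biholomorphism $\varphi$ of $N$ with $[\varphi^*g]=[g]$. A homothety of a Kähler manifold $(K,k,J)$ is a biholomorphism $\varphi$ of $K$ with $\varphi^*k=\lambda k$ for a constant $\lambda>0$; its dilation factor is $\rho(\varphi)=\lambda$. Statement. Let $(\tilde M,[\tilde g],J)$ be a globally conformal Kähler manifold with $\dim_{\mathbb C}\tilde M\ge 2$, and let $\Gamma$ be a group of automorphisms of $(\tilde M,[\tilde g],J)$ acting freely and properly discontinuously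 on $\tilde M$ (for compact $K,L\subset\tilde M$ only finitely many $\gamma\in\Gamma$ satisfy $\gamma K\cap L\ne\emptyset$). Let $p:\tilde M\to M=\tilde M/\Gamma$ be the projection. Then $M$, with its naturally induced complex structure (for which $p$ is locally biholomorphic), is a complex manifold, and it carries a locally conformal Kähler structure $[g]$ with $[p^*g]=[\tilde g]$. This structure is unique: every Hermitian metric $g'$ on $M$ with $[p^*g']=[\tilde g]$ satisfies $[g']=[g]$. Assume moreover that $\tilde M$ is connected and that $\Gamma$ consists of homotheties with respect to the Kähler metrics in $[\tilde g]$. Then $(M,[g],J)$ is globally conformal Kähler if and only if $\rho(\Gamma)=1$, i.e. every $\gamma\in\Gamma$ has dilation factor $1$. -/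

import Mathlib

open scoped Manifold ContDiff Topology

noncomputable section

namespace LCK

/-! ### Complex manifolds and their biholomorphisms

A complex manifold is a manifold `M` modelled on a finite-dimensional complex vector space `E`, with
`IsManifold 𝓘(ℂ, E) ω M`. The same charts make it a smooth real manifold, with model `𝓘(ℝ, E)`. -/

section Manifold

variable {E : Type*} [NormedAddCommGroup E] [NormedSpace ℂ E]
  {M : Type*} [TopologicalSpace M] [ChartedSpace E M]

/-- The smooth real manifold underlying a complex manifold. -/
instance isManifold_real [IsManifold 𝓘(ℂ, E) ω M] : IsManifold 𝓘(ℝ, E) ω M := by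
  refine isManifold_of_contDiffOn 𝓘(ℝ, E) ω M fun e e' he he' => ?_
  have h : ContDiffOn ℂ ω (𝓘(ℂ, E) ∘ e.symm ≫ₕ e' ∘ 𝓘(ℂ, E).symm)
      (𝓘(ℂ, E).symm ⁻¹' (e.symm ≫ₕ e').source ∩ Set.range 𝓘(ℂ, E)) :=
    ((contDiffGroupoid ω 𝓘(ℂ, E)).compatible he he').1
  exact h.restrict_scalars ℝ

variable (E M) in
/-- The biholomorphic maps of a complex manifold onto itself. -/
abbrev Biholomorphism : Type _ := Diffeomorph 𝓘(ℂ, E) 𝓘(ℂ, E) M M ω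

instance : Group (Biholomorphism E M) where
  mul φ ψ := ψ.trans φ
  one := Diffeomorph.refl 𝓘(ℂ, E) M ω
  inv φ := φ.symm
  mul_assoc _ _ _ := rfl
  one_mul _ := rfl
  mul_one _ := rfl
  inv_mul_cancel φ := Diffeomorph.ext fun x => φ.symm_apply_apply x

instance : MulAction (Biholomorphism E M) M where
  smul φ x := φ x
  one_smul _ := rfl
  mul_smul _ _ _ := rfl

instance : ContinuousConstSMul (Biholomorphism E M) M where
  continuous_const_smul φ := φ.continuous

instance (Γ : Subgroup (Biholomorphism E M)) : ContinuousConstSMul Γ M where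
  continuous_const_smul γ := γ.1.continuous

end Manifold

/-! ### The quotient by a free and properly discontinuous group of biholomorphisms -/

section Quotient

open MulAction

variable {E : Type*} [NormedAddCommGroup E] [NormedSpace ℂ E]
  {M : Type*} [TopologicalSpace M] [ChartedSpace E M]

/-- The projection onto the space of orbits. -/
abbrev proj (Γ : Subgroup (Biholomorphism E M)) (x : M) : orbitRel.Quotient Γ M :=
  Quotient.mk (orbitRel Γ M) x

variable [FiniteDimensional ℂ E] [T2Space M] (Γ : Subgroup (Biholomorphism E M))
  [IsCancelSMul Γ M] [ProperlyDiscontinuousSMul Γ M]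

theorem isLocalHomeomorph_proj : IsLocalHomeomorph (proj Γ) :=
  haveI : ProperSpace E := FiniteDimensional.proper ℂ E
  haveI : LocallyCompactSpace M := ChartedSpace.locallyCompactSpace E M
  isQuotientCoveringMap_quotientMk_of_properlyDiscontinuousSMul.isCoveringMap.isLocalHomeomorph

/-- The naturally induced charts of the quotient: local inverses of the projection, followed by the
charts of `M`. -/
instance quotientChartedSpace : ChartedSpace E (orbitRel.Quotient Γ M) :=
  haveI : ProperSpace E := FiniteDimensional.proper ℂ E
  haveI : LocallyCompactSpace M := ChartedSpace.locallyCompactSpace E M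
  MulAction.instChartedSpaceQuotient

theorem exists_chart_eq {e : OpenPartialHomeomorph (orbitRel.Quotient Γ M) E}
    (he : e ∈ atlas E (orbitRel.Quotient Γ M)) :
    ∃ x : M, e = ((isLocalHomeomorph_proj Γ).localInverseAt x).trans (chartAt E x) := by
  obtain ⟨q, hq⟩ := he
  exact ⟨_, hq.symm⟩

/-- The quotient is a complex manifold. -/
instance quotientIsManifold [IsManifold 𝓘(ℂ, E) ω M] :
    IsManifold 𝓘(ℂ, E) ω (orbitRel.Quotient Γ M) := by
  refine isManifold_of_contDiffOn 𝓘(ℂ, E) ω _ fun e e' he he' => ?_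
  obtain ⟨a, rfl⟩ := exists_chart_eq Γ he
  obtain ⟨b, rfl⟩ := exists_chart_eq Γ he'
  have hp := isLocalHomeomorph_proj Γ
  intro y hy
  simp only [modelWithCornersSelf_coe, modelWithCornersSelf_coe_symm, Set.range_id, Set.inter_univ,
    Set.preimage_id, Function.comp_id, Function.id_comp] at hy ⊢
  simp only [OpenPartialHomeomorph.trans_source, OpenPartialHomeomorph.symm_source,
    OpenPartialHomeomorph.trans_target, Set.mem_inter_iff, Set.mem_preimage,
    OpenPartialHomeomorph.coe_trans_symm, Function.comp_apply,
    IsLocalHomeomorph.localInverseAt_symm] at hy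
  obtain ⟨⟨hy1, hy2⟩, hy3, hy4⟩ := hy
  set x := (chartAt E a).symm y with hx
  set σ := hp.localInverseAt b with hσ
  have hrel : proj Γ (σ (proj Γ x)) = proj Γ x := hp.apply_localInverseAt_of_mem hy3
  obtain ⟨γ, hγ⟩ := Quotient.exact hrel
  replace hγ : γ • x = σ (proj Γ x) := hγ
  have hγt : γ • x ∈ σ.target := hγ ▸ σ.map_source hy3
  have hγc : γ • x ∈ (chartAt E b).source := hγ ▸ hy4
  have hcγ : Continuous fun z : M => γ • z := continuous_const_smul γ
  have hcx : ContinuousAt (chartAt E a).symm y := (chartAt E a).continuousAt_symm hy1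
  have hev : ∀ᶠ z in 𝓝 x, σ (proj Γ z) = γ • z := by
    filter_upwards [hcγ.continuousAt.preimage_mem_nhds (σ.open_target.mem_nhds hγt)] with z hz
    have h1 : proj Γ z = proj Γ (γ • z) := Quotient.sound ⟨γ⁻¹, inv_smul_smul γ z⟩
    have h2 : proj Γ (γ • z) = σ.symm (γ • z) := by
      rw [hσ, hp.localInverseAt_symm]
    rw [h1, h2]
    exact σ.right_inv hz
  have hγm : ContMDiff 𝓘(ℂ, E) 𝓘(ℂ, E) ω fun z : M => γ • z := γ.1.contMDiff
  have h3 : ContMDiffAt 𝓘(ℂ, E) 𝓘(ℂ, E) ω (fun z => chartAt E b (γ • (chartAt E a).symm z)) y :=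
    (contMDiffAt_of_mem_maximalAtlas (IsManifold.chart_mem_maximalAtlas b) hγc).comp y
      (hγm.contMDiffAt.comp y (contMDiffOn_symm_of_mem_maximalAtlas
        (IsManifold.chart_mem_maximalAtlas a) |>.contMDiffAt
          ((chartAt E a).open_target.mem_nhds hy1)))
  refine (h3.contDiffAt.congr_of_eventuallyEq ?_).contDiffWithinAt
  filter_upwards [hcx.eventually hev] with z hz
  simp only [OpenPartialHomeomorph.coe_trans, OpenPartialHomeomorph.coe_trans_symm,
    Function.comp_apply, IsLocalHomeomorph.localInverseAt_symm]
  rw [← hz]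

end Quotient

/-! ### Hermitian, Kähler and locally conformal Kähler metrics -/

section Tensor

variable (E : Type*) [NormedAddCommGroup E] [NormedSpace ℂ E]
  (M : Type*) [TopologicalSpace M] [ChartedSpace E M]

/-- Fields of (continuous) real bilinear forms on the real tangent spaces of `M`. -/
abbrev BilinField : Type _ :=
  ∀ x : M, TangentSpace 𝓘(ℝ, E) x →L[ℝ] TangentSpace 𝓘(ℝ, E) x →L[ℝ] ℝ

variable {E M}

/-- The complex structure `J` of the real tangent space: in the charts of `M`, it is the
multiplication by `i` of `E`. -/
def complexStructure (x : M) : TangentSpace 𝓘(ℝ, E) x →L[ℝ] TangentSpace 𝓘(ℝ, E) x :=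
  (Complex.I • ContinuousLinearMap.id ℝ E : E →L[ℝ] E)

variable {E' : Type*} [NormedAddCommGroup E'] [NormedSpace ℂ E']
  {N : Type*} [TopologicalSpace N] [ChartedSpace E' N]

/-- The pull-back `f^* T`, namely `(f^* T)(v, w) = T(df v, df w)`. -/
def pullback (f : M → N) (T : BilinField E' N) : BilinField E M := fun x =>
  let A := mfderiv 𝓘(ℝ, E) 𝓘(ℝ, E') f x
  (ContinuousLinearMap.precomp ℝ A).comp ((T (f x)).comp A)

/-- `T` and `T'` are (globally) conformal: `T' = e^α T` for a smooth function `α`. -/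
def ConformalTo (T T' : BilinField E M) : Prop :=
  ∃ α : M → ℝ, ContMDiff 𝓘(ℝ, E) 𝓘(ℝ, ℝ) ∞ α ∧ ∀ x, T' x = Real.exp (α x) • T x

/-- The exterior derivative at `x` of a field `Ω` of alternating bilinear forms, computed in the
chart at `x` (where the tangent space at `x` is `E`):
`dΩ(u, v, w) = ∂_u Ω(v, w) - ∂_v Ω(u, w) + ∂_w Ω(u, v)`. -/
def extDerivForm (Ω : BilinField E M) (x : M) (u v w : E) : ℝ :=
  let coeff : E → E → E → ℝ := fun a b y => pullback (chartAt E x).symm Ω y a b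
  let y := chartAt E x x
  fderiv ℝ (coeff v w) y u - fderiv ℝ (coeff u w) y v + fderiv ℝ (coeff u v) y w

/-- The fundamental form `Ω(X, Y) = g(JX, Y)`. -/
def fundamentalForm (g : BilinField E M) : BilinField E M := fun x =>
  (g x).comp (complexStructure x)

end Tensor

section Metric

variable (E : Type*) [NormedAddCommGroup E] [NormedSpace ℂ E]
  (M : Type*) [TopologicalSpace M] [ChartedSpace E M] [IsManifold 𝓘(ℂ, E) ω M]

/-- A Hermitian metric on a complex manifold: a smooth Riemannian metric `g` on the underlying real
manifold with `g(JX, JY) = g(X, Y)`. -/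
structure HermitianMetric extends
    Bundle.ContMDiffRiemannianMetric 𝓘(ℝ, E) ∞ E (fun x : M => TangentSpace 𝓘(ℝ, E) x) where
  hermitian (x : M) (v w : TangentSpace 𝓘(ℝ, E) x) :
    inner x (complexStructure x v) (complexStructure x w) = inner x v w

variable {E M}

/-- The metric as a field of bilinear forms. -/
abbrev HermitianMetric.form (g : HermitianMetric E M) : BilinField E M := g.inner

/-- `g` is Kähler: its fundamental form is closed. -/
def HermitianMetric.IsKahler (g : HermitianMetric E M) : Prop :=
  ∀ (x : M) (u v w : E), extDerivForm (fundamentalForm g.form) x u v w = 0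

/-- `g` is locally conformal Kähler: around every point there is a smooth function `α` such that
`e^α g` is Kähler. -/
def HermitianMetric.IsLCK (g : HermitianMetric E M) : Prop :=
  ∀ x₀ : M, ∃ U : Set M, IsOpen U ∧ x₀ ∈ U ∧ ∃ α : M → ℝ,
    ContMDiffOn 𝓘(ℝ, E) 𝓘(ℝ, ℝ) ∞ α U ∧
    ∀ x ∈ U, ∀ u v w : E,
      extDerivForm (fundamentalForm fun y => Real.exp (α y) • g.form y) x u v w = 0

/-- `g` is globally conformal Kähler: its conformal class contains a Kähler metric. -/
def HermitianMetric.IsGCK (g : HermitianMetric E M) : Prop :=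
  ∃ k : HermitianMetric E M, k.IsKahler ∧ ConformalTo g.form k.form

/-- The biholomorphism `φ` is an automorphism of `(M, [g], J)`: `[φ^* g] = [g]`. -/
def HermitianMetric.IsAutomorphism (g : HermitianMetric E M) (φ : Biholomorphism E M) : Prop :=
  ConformalTo (pullback φ g.form) g.form

/-- The biholomorphism `φ` is a homothety of `k` of dilation factor `c`: `φ^* k = c k`. -/
def HermitianMetric.HasDilationFactor (k : HermitianMetric E M) (φ : Biholomorphism E M) (c : ℝ) :
    Prop :=
  0 < c ∧ ∀ x, pullback φ k.form x = c • k.form x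

/-- `φ` is a homothety of `k`. -/
def HermitianMetric.IsHomothety (k : HermitianMetric E M) (φ : Biholomorphism E M) : Prop :=
  ∃ c : ℝ, k.HasDilationFactor φ c

open Classical in
/-- The dilation factor `ρ(φ)` of a homothety `φ` of `k`. -/
def HermitianMetric.dilationFactor (k : HermitianMetric E M) (φ : Biholomorphism E M) : ℝ :=
  if h : k.IsHomothety φ then h.choose else 1

theorem HermitianMetric.HasDilationFactor.dilationFactor_eq [Nonempty M] [Nontrivial E]
    {k : HermitianMetric E M} {φ : Biholomorphism E M} {c : ℝ} (h : k.HasDilationFactor φ c) :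
    k.dilationFactor φ = c := by
  have h' : k.IsHomothety φ := ⟨c, h⟩
  have h1 := h'.choose_spec
  rw [dilationFactor, dif_pos h']
  obtain ⟨x⟩ := ‹Nonempty M›
  obtain ⟨v, hv⟩ := exists_ne (0 : E)
  have h2 := (h1.2 x).symm.trans (h.2 x)
  have h3 := congrArg (fun B => B v v) h2
  have h4 : h'.choose * k.form x v v = c * k.form x v v := h3
  exact mul_right_cancel₀ (k.pos x v hv).ne' h4

end Metric

end LCK

end

open LCK

/-!
The pull-back of forms by a local biholomorphism `f` is invertible at each point, so a field of
forms on the source can be transported to the target from any point of a fibre of `f`, and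
descends as soon as the transports from the points of each fibre agree. For the projection
`p : M → M / Γ`, the transports of `g̃` from two points of a fibre are only proportional,
because `Γ` preserves the conformal class. Their positive multiples form a convex cone over each
point, and local sections of `p` give smooth fields in it; a partition of unity glues these to a
metric `g` with `[p^*g] = [g̃]`. Since `d` commutes with pull-backs, being Kähler is a local
property, preserved and reflected by `p`, and so is being locally conformal Kähler.

If `k` and `c k` are both Kähler, then `dc ∧ Ω = 0`, which in complex dimension at least `2` forces
`dc = 0`: conformal Kähler metrics on a connected manifold are homothetic. If `g` is globally
conformal Kähler, then `k` is therefore a constant multiple of the pull-back of a Kähler metric on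
the quotient, and `Γ` acts by isometries of `k`. Conversely, if `Γ` acts by isometries of `k`, then
`k` itself descends to a Kähler metric in `[g]`.
-/

noncomputable section

namespace LCK

/-! ### Bilinear forms -/

section BilinearForm

variable {V W X : Type*} [NormedAddCommGroup V] [NormedSpace ℝ V] [NormedAddCommGroup W]
  [NormedSpace ℝ W] [NormedAddCommGroup X] [NormedSpace ℝ X]

-- Instance search does not find this one by itself.
instance isBoundedSMul_bilinearForm : IsBoundedSMul ℝ (V →L[ℝ] V →L[ℝ] ℝ) :=
  NormedSpace.toIsBoundedSMul (𝕜 := ℝ) (E := V →L[ℝ] V →L[ℝ] ℝ)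

theorem contDiffAt_flip {n : WithTop ℕ∞} {B : X → V →L[ℝ] W →L[ℝ] ℝ} {x : X}
    (hB : ContDiffAt ℝ n B x) : ContDiffAt ℝ n (fun y => (B y).flip) x := by
  have hflip := ContinuousLinearMap.contDiff (𝕜 := ℝ) (n := n) (E := V →L[ℝ] W →L[ℝ] ℝ)
    (F := W →L[ℝ] V →L[ℝ] ℝ) (ContinuousLinearMap.flipₗᵢ ℝ V W ℝ).toContinuousLinearEquiv
  exact hflip.contDiffAt.comp x hB

theorem contDiffAt_bilinearComp {n : WithTop ℕ∞} {B : X → W →L[ℝ] W →L[ℝ] ℝ}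
    {A : X → V →L[ℝ] W} {x : X} (hB : ContDiffAt ℝ n B x) (hA : ContDiffAt ℝ n A x) :
    ContDiffAt ℝ n (fun y => (B y).bilinearComp (A y) (A y)) x :=
  contDiffAt_flip ((contDiffAt_flip (hB.clm_comp hA)).clm_comp hA)

/-- The exterior derivative of a field `B` of bilinear forms on a vector space, by the formula
`∂_u B(v, w) - ∂_v B(u, w) + ∂_w B(u, v)`; it is the usual one when `B` is alternating. -/
def flatExtDeriv (B : V → V →L[ℝ] V →L[ℝ] ℝ) (y u v w : V) : ℝ :=
  fderiv ℝ (fun z => B z v w) y u - fderiv ℝ (fun z => B z u w) y v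
    + fderiv ℝ (fun z => B z u v) y w

theorem flatExtDeriv_congr {B B' : V → V →L[ℝ] V →L[ℝ] ℝ} {y : V} (h : B =ᶠ[𝓝 y] B') (u v w : V) :
    flatExtDeriv B y u v w = flatExtDeriv B' y u v w := by
  have h' (a b : V) : fderiv ℝ (fun z => B z a b) y = fderiv ℝ (fun z => B' z a b) y :=
    Filter.EventuallyEq.fderiv_eq (h.mono fun z hz => by simp only [hz])
  simp only [flatExtDeriv, h']

theorem flatExtDeriv_eq {B : V → V →L[ℝ] V →L[ℝ] ℝ} {y : V} (hB : DifferentiableAt ℝ B y)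
    (u v w : V) : flatExtDeriv B y u v w =
      fderiv ℝ B y u v w - fderiv ℝ B y v u w + fderiv ℝ B y w u v := by
  have h (a b c : V) : fderiv ℝ (fun z => B z a b) y c = fderiv ℝ B y c a b := by
    rw [((hB.hasFDerivAt.clm_apply (hasFDerivAt_const a y)).clm_apply
      (hasFDerivAt_const b y)).fderiv]
    simp
  simp only [flatExtDeriv, h]

theorem fderiv_bilinearComp_fderiv_apply {F : V → W} {B : W → W →L[ℝ] W →L[ℝ] ℝ} {y : V}
    (hF : ContDiffAt ℝ 2 F y) (hB : DifferentiableAt ℝ B (F y)) (a b c : V) :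
    fderiv ℝ (fun z => (B (F z)).bilinearComp (fderiv ℝ F z) (fderiv ℝ F z) a b) y c =
      fderiv ℝ B (F y) (fderiv ℝ F y c) (fderiv ℝ F y a) (fderiv ℝ F y b)
      + B (F y) (fderiv ℝ (fderiv ℝ F) y c a) (fderiv ℝ F y b)
      + B (F y) (fderiv ℝ F y a) (fderiv ℝ (fderiv ℝ F) y c b) := by
  have hF' : DifferentiableAt ℝ (fderiv ℝ F) y :=
    (hF.fderiv_right (m := 1) (by norm_num)).differentiableAt (by norm_num)
  have hBF : HasFDerivAt (fun z => B (F z)) ((fderiv ℝ B (F y)).comp (fderiv ℝ F y)) y :=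
    HasFDerivAt.comp (g := B) y hB.hasFDerivAt (hF.differentiableAt (by norm_num)).hasFDerivAt
  have hdF (v : V) := hF'.hasFDerivAt.clm_apply (hasFDerivAt_const v y)
  simp only [ContinuousLinearMap.bilinearComp_apply]
  rw [((hBF.clm_apply (hdF a)).clm_apply (hdF b)).fderiv]
  simp
  ring

theorem flatExtDeriv_bilinearComp_fderiv {F : V → W} {B : W → W →L[ℝ] W →L[ℝ] ℝ} {y : V}
    (hF : ContDiffAt ℝ 2 F y) (hB : DifferentiableAt ℝ B (F y))
    (hanti : ∀ a b, B (F y) a b = -B (F y) b a) (u v w : V) :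
    flatExtDeriv (fun z => (B (F z)).bilinearComp (fderiv ℝ F z) (fderiv ℝ F z)) y u v w =
      flatExtDeriv B (F y) (fderiv ℝ F y u) (fderiv ℝ F y v) (fderiv ℝ F y w) := by
  have hsymm (a b : V) : fderiv ℝ (fderiv ℝ F) y a b = fderiv ℝ (fderiv ℝ F) y b a :=
    (hF.isSymmSndFDerivAt (by simp)).eq a b
  rw [flatExtDeriv_eq hB]
  simp only [flatExtDeriv, fderiv_bilinearComp_fderiv_apply hF hB]
  -- The terms with second derivatives of `F` cancel in pairs.
  rw [hanti (fderiv ℝ (fderiv ℝ F) y w u), hanti (fderiv ℝ F y v), hsymm v u, hsymm w v,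
    hsymm w u, hanti (fderiv ℝ F y v)]
  ring

theorem flatExtDeriv_smul {c : V → ℝ} {B : V → V →L[ℝ] V →L[ℝ] ℝ} {y : V}
    (hc : DifferentiableAt ℝ c y) (hB : DifferentiableAt ℝ B y) (u v w : V) :
    flatExtDeriv (fun z => c z • B z) y u v w = c y * flatExtDeriv B y u v w +
      (fderiv ℝ c y u * B y v w - fderiv ℝ c y v * B y u w + fderiv ℝ c y w * B y u v) := by
  have h : HasFDerivAt (fun z => c z • B z) _ y :=
    HasFDerivAt.smul (f := B) hc.hasFDerivAt hB.hasFDerivAt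
  rw [flatExtDeriv_eq hB, flatExtDeriv_eq h.differentiableAt, h.fderiv]
  simp
  ring

theorem bilinearComp_injective {A : V →L[ℝ] W} (hA : Function.Surjective A) :
    Function.Injective fun B : W →L[ℝ] W →L[ℝ] ℝ => B.bilinearComp A A := by
  intro B B' h
  ext v w
  obtain ⟨v, rfl⟩ := hA v
  obtain ⟨w, rfl⟩ := hA w
  exact DFunLike.congr_fun (DFunLike.congr_fun h v) w

theorem exists_pos_mul_sq_norm_le [FiniteDimensional ℝ V] {B : V →L[ℝ] V →L[ℝ] ℝ}
    (hB : ∀ v, v ≠ 0 → 0 < B v v) : ∃ m > 0, ∀ v, m * ‖v‖ ^ 2 ≤ B v v := by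
  rcases subsingleton_or_nontrivial V with hV | hV
  · exact ⟨1, one_pos, fun v => by simp [Subsingleton.elim v 0]⟩
  have : ProperSpace V := FiniteDimensional.proper ℝ V
  obtain ⟨v₀, hv₀, hmin⟩ := (isCompact_sphere (0 : V) 1).exists_isMinOn
    (NormedSpace.sphere_nonempty.2 zero_le_one) (f := fun v => B v v) (by fun_prop)
  have hv₀_ne : v₀ ≠ 0 := ne_zero_of_mem_unit_sphere ⟨v₀, hv₀⟩
  refine ⟨B v₀ v₀, hB v₀ hv₀_ne, fun v => ?_⟩
  rcases eq_or_ne v 0 with rfl | hv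
  · simp
  have hle : B v₀ v₀ ≤ B (‖v‖⁻¹ • v) (‖v‖⁻¹ • v) := hmin (by simp [norm_smul, hv])
  have : 0 < ‖v‖ := norm_pos_iff.2 hv
  simp only [map_smul, smul_apply, smul_eq_mul] at hle
  calc B v₀ v₀ * ‖v‖ ^ 2 ≤ (‖v‖⁻¹ * (‖v‖⁻¹ * B v v)) * ‖v‖ ^ 2 := by gcongr
    _ = B v v := by field_simp

theorem isVonNBounded_setOf_apply_self_lt_one [FiniteDimensional ℝ V] {B : V →L[ℝ] V →L[ℝ] ℝ}
    (hB : ∀ v, v ≠ 0 → 0 < B v v) : Bornology.IsVonNBounded ℝ {v : V | B v v < 1} := by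
  obtain ⟨m, hm, hle⟩ := exists_pos_mul_sq_norm_le hB
  rw [NormedSpace.isVonNBounded_iff]
  refine (Metric.isBounded_closedBall (x := (0 : V)) (r := √(1 / m))).subset fun v hv => ?_
  rw [mem_closedBall_zero_iff]
  refine Real.le_sqrt_of_sq_le ?_
  rw [le_div_iff₀' hm]
  exact (hle v).trans (le_of_lt hv)

end BilinearForm

section HermitianForm

variable {E : Type*} [NormedAddCommGroup E] [NormedSpace ℂ E]
  {E' : Type*} [NormedAddCommGroup E'] [NormedSpace ℂ E']

/-- `B` is the real part of a Hermitian scalar product: a real scalar product on a complex vector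
space that is invariant under multiplication by `i`. -/
structure IsHermitianForm (B : E →L[ℝ] E →L[ℝ] ℝ) : Prop where
  symm (v w : E) : B v w = B w v
  pos (v : E) (hv : v ≠ 0) : 0 < B v v
  map_I_smul (v w : E) : B (Complex.I • v) (Complex.I • w) = B v w

namespace IsHermitianForm

theorem smul {B : E →L[ℝ] E →L[ℝ] ℝ} (hB : IsHermitianForm B) {c : ℝ} (hc : 0 < c) :
    IsHermitianForm (c • B) where
  symm v w := congrArg (c * ·) (hB.symm v w)
  pos v hv := mul_pos hc (hB.pos v hv)
  map_I_smul v w := congrArg (c * ·) (hB.map_I_smul v w)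

theorem bilinearComp {B : E' →L[ℝ] E' →L[ℝ] ℝ} (hB : IsHermitianForm B) {A : E →L[ℝ] E'}
    (hA : Function.Injective A) (hAI : ∀ v, A (Complex.I • v) = Complex.I • A v) :
    IsHermitianForm (B.bilinearComp A A) where
  symm _ _ := hB.symm _ _
  pos _ hv := hB.pos _ ((map_ne_zero_iff A hA).2 hv)
  map_I_smul v w := by
    simp only [ContinuousLinearMap.bilinearComp_apply, hAI, hB.map_I_smul]

theorem ne_zero [Nontrivial E] {B : E →L[ℝ] E →L[ℝ] ℝ} (hB : IsHermitianForm B) : B ≠ 0 := by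
  rintro rfl
  obtain ⟨v, hv⟩ := exists_ne (0 : E)
  exact (hB.pos v hv).ne rfl

theorem apply_I_smul_antisymm {B : E →L[ℝ] E →L[ℝ] ℝ} (hB : IsHermitianForm B) (v w : E) :
    B (Complex.I • v) w = -B (Complex.I • w) v := by
  rw [hB.symm, ← hB.map_I_smul, smul_smul, Complex.I_mul_I]
  simp

theorem eq_zero_of_wedge_eq_zero [FiniteDimensional ℂ E] (hE : 2 ≤ Module.finrank ℂ E)
    {B : E →L[ℝ] E →L[ℝ] ℝ} (hB : IsHermitianForm B) {θ : E →L[ℝ] ℝ}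
    (h : ∀ u v w, θ u * B (Complex.I • v) w - θ v * B (Complex.I • u) w +
      θ w * B (Complex.I • u) v = 0) : θ = 0 := by
  have : FiniteDimensional ℝ E := FiniteDimensional.complexToReal E
  ext u
  -- Evaluate at `u`, `v`, `iv`, where `v ≠ 0` is orthogonal to `u` and `iu`.
  let L : E →ₗ[ℝ] ℝ × ℝ := (B u : E →ₗ[ℝ] ℝ).prod (B (Complex.I • u) : E →ₗ[ℝ] ℝ)
  have hker : LinearMap.ker L ≠ ⊥ := by
    refine LinearMap.ker_ne_bot_of_finrank_lt ?_
    rw [finrank_real_of_complex, Module.finrank_prod, Module.finrank_self]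
    omega
  obtain ⟨v, hv, hv_ne⟩ := (Submodule.ne_bot_iff _).1 hker
  obtain ⟨huv, hIuv⟩ : B u v = 0 ∧ B (Complex.I • u) v = 0 := by simpa [L] using hv
  have huvIv := h u v (Complex.I • v)
  rw [hB.map_I_smul, hB.map_I_smul, huv, hIuv] at huvIv
  simpa [(hB.pos v hv_ne).ne'] using huvIv

end IsHermitianForm

end HermitianForm

/-! ### Fields of bilinear forms in charts -/

section Differential

variable {E : Type*} [NormedAddCommGroup E] [NormedSpace ℂ E]
  {M : Type*} [TopologicalSpace M] [ChartedSpace E M]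
  {E' : Type*} [NormedAddCommGroup E'] [NormedSpace ℂ E']
  {N : Type*} [TopologicalSpace N] [ChartedSpace E' N]

theorem contMDiffWithinAt_real {n : WithTop ℕ∞} {f : M → N} {s : Set M} {x : M}
    (h : ContMDiffWithinAt 𝓘(ℂ, E) 𝓘(ℂ, E') n f s x) :
    ContMDiffWithinAt 𝓘(ℝ, E) 𝓘(ℝ, E') n f s x := by
  rw [contMDiffWithinAt_iff] at h ⊢
  exact ⟨h.1, h.2.restrict_scalars ℝ⟩

theorem contMDiffAt_real {n : WithTop ℕ∞} {f : M → N} {x : M}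
    (h : ContMDiffAt 𝓘(ℂ, E) 𝓘(ℂ, E') n f x) : ContMDiffAt 𝓘(ℝ, E) 𝓘(ℝ, E') n f x :=
  contMDiffWithinAt_real h

theorem isLocalDiffeomorphAt_real {n : WithTop ℕ∞} {f : M → N} {x : M}
    (h : IsLocalDiffeomorphAt 𝓘(ℂ, E) 𝓘(ℂ, E') n f x) :
    IsLocalDiffeomorphAt 𝓘(ℝ, E) 𝓘(ℝ, E') n f x := by
  obtain ⟨Φ, hx, hf⟩ := h
  exact ⟨⟨Φ.toPartialEquiv, Φ.open_source, Φ.open_target,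
    fun y hy => contMDiffWithinAt_real (Φ.contMDiffOn_toFun y hy),
    fun y hy => contMDiffWithinAt_real (Φ.contMDiffOn_invFun y hy)⟩, hx, hf⟩

variable (E E') in
/-- The real differential of `f` at `x`, as a map of the model spaces: the tangent space at any
point is a copy of the model space, but the type of `mfderiv` depends on the point. -/
def diffAt (f : M → N) (x : M) : E →L[ℝ] E' :=
  mfderiv 𝓘(ℝ, E) 𝓘(ℝ, E') f x

theorem diffAt_comp {E'' : Type*} [NormedAddCommGroup E''] [NormedSpace ℂ E'']
    {P : Type*} [TopologicalSpace P] [ChartedSpace E'' P] {g : N → P} {f : M → N} {x : M}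
    (hg : MDifferentiableAt 𝓘(ℝ, E') 𝓘(ℝ, E'') g (f x))
    (hf : MDifferentiableAt 𝓘(ℝ, E) 𝓘(ℝ, E') f x) :
    diffAt E E'' (g ∘ f) x = (diffAt E' E'' g (f x)).comp (diffAt E E' f x) :=
  mfderiv_comp x hg hf

theorem diffAt_congr {f f' : M → N} {x : M} (h : f =ᶠ[𝓝 x] f') :
    diffAt E E' f x = diffAt E E' f' x :=
  h.mfderiv_eq

theorem diffAt_eq_fderiv (f : E → E') (x : E) : diffAt E E' f x = fderiv ℝ f x :=
  mfderiv_eq_fderiv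

theorem diffAt_eq_fderiv_writtenInExtChartAt {f : M → N} {x : M}
    (hf : MDifferentiableAt 𝓘(ℝ, E) 𝓘(ℝ, E') f x) :
    diffAt E E' f x =
      fderiv ℝ (writtenInExtChartAt 𝓘(ℝ, E) 𝓘(ℝ, E') x f) (chartAt E x x) := by
  refine hf.mfderiv.trans ?_
  rw [modelWithCornersSelf_coe, Set.range_id, fderivWithin_univ]
  rfl

theorem isInvertible_diffAt {f : M → N} {x : M}
    (hf : IsLocalDiffeomorphAt 𝓘(ℂ, E) 𝓘(ℂ, E') ω f x) : (diffAt E E' f x).IsInvertible :=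
  ⟨(isLocalDiffeomorphAt_real hf).mfderivToContinuousLinearEquiv (by simp), rfl⟩

theorem diffAt_smul {f : M → N} {x : M} (hf : MDifferentiableAt 𝓘(ℂ, E) 𝓘(ℂ, E') f x)
    (c : ℂ) (v : E) : diffAt E E' f x (c • v) = c • diffAt E E' f x v := by
  have hF : DifferentiableAt ℂ (writtenInExtChartAt 𝓘(ℂ, E) 𝓘(ℂ, E') x f) (chartAt E x x) := by
    simpa [DifferentiableWithinAtProp, differentiableWithinAt_univ] using hf.2
  have hf_real : MDifferentiableAt 𝓘(ℝ, E) 𝓘(ℝ, E') f x :=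
    ⟨hf.1, by simpa [DifferentiableWithinAtProp, differentiableWithinAt_univ]
      using hF.restrictScalars ℝ⟩
  rw [diffAt_eq_fderiv_writtenInExtChartAt hf_real]
  exact DFunLike.congr_fun (hF.fderiv_restrictScalars ℝ) (c • v) |>.trans
    ((fderiv ℂ _ _).map_smul c v) |>.trans
      (congrArg (c • ·) (DFunLike.congr_fun (hF.fderiv_restrictScalars ℝ) v).symm)

theorem contDiffAt_writtenInExtChartAt {n : WithTop ℕ∞} {f : M → N} {x : M}
    (hf : ContMDiffAt 𝓘(ℝ, E) 𝓘(ℝ, E') n f x) :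
    ContDiffAt ℝ n (writtenInExtChartAt 𝓘(ℝ, E) 𝓘(ℝ, E') x f) (chartAt E x x) := by
  simpa [contDiffWithinAt_univ] using (contMDiffAt_iff.1 hf).2

theorem writtenInExtChartAt_chartAt_self (f : M → N) (x : M) :
    writtenInExtChartAt 𝓘(ℝ, E) 𝓘(ℝ, E') x f (chartAt E x x) = chartAt E' (f x) (f x) := by
  simp [writtenInExtChartAt]

theorem contDiffAt_comp_chartAt_symm {n : WithTop ℕ∞} {F : Type*} [NormedAddCommGroup F]
    [NormedSpace ℝ F] {c : M → F} {x : M} (hc : ContMDiffAt 𝓘(ℝ, E) 𝓘(ℝ, F) n c x) :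
    ContDiffAt ℝ n (c ∘ (chartAt E x).symm) (chartAt E x x) := by
  simpa [contDiffWithinAt_univ, chartAt_self_eq] using (contMDiffAt_iff.1 hc).2

theorem diffAt_comp_diffAt_chartAt_symm [IsManifold 𝓘(ℂ, E) ω M] [IsManifold 𝓘(ℂ, E') ω N]
    {f : M → N} {x : M} {y : E} (hy : y ∈ (chartAt E x).target)
    (hf : MDifferentiableAt 𝓘(ℝ, E) 𝓘(ℝ, E') f ((chartAt E x).symm y))
    (hfy : f ((chartAt E x).symm y) ∈ (chartAt E' (f x)).source) :
    let F := writtenInExtChartAt 𝓘(ℝ, E) 𝓘(ℝ, E') x f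
    (diffAt E E' f ((chartAt E x).symm y)).comp (diffAt E E (chartAt E x).symm y) =
      (diffAt E' E' (chartAt E' (f x)).symm (F y)).comp (fderiv ℝ F y) := by
  intro F
  set φ := chartAt E x
  set ψ := chartAt E' (f x)
  have := IsManifold.of_le (I := 𝓘(ℝ, E)) (M := M) (m := 1) (n := ω) (by simp)
  have := IsManifold.of_le (I := 𝓘(ℝ, E')) (M := N) (m := 1) (n := ω) (by simp)
  have hφ : MDifferentiableAt 𝓘(ℝ, E) 𝓘(ℝ, E) φ.symm y :=
    mdifferentiableAt_atlas_symm (chart_mem_atlas E x) hy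
  have hψ : MDifferentiableAt 𝓘(ℝ, E') 𝓘(ℝ, E') ψ (f (φ.symm y)) :=
    mdifferentiableAt_atlas (chart_mem_atlas E' (f x)) hfy
  have hψ_symm : MDifferentiableAt 𝓘(ℝ, E') 𝓘(ℝ, E') ψ.symm (F y) :=
    mdifferentiableAt_atlas_symm (chart_mem_atlas E' (f x)) (ψ.map_source hfy)
  have hcomp : f ∘ φ.symm =ᶠ[𝓝 y] ψ.symm ∘ F := by
    filter_upwards [(hf.comp y hφ).continuousAt.preimage_mem_nhds (ψ.open_source.mem_nhds hfy)]
      with z hz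
    exact (ψ.left_inv hz).symm
  rw [← diffAt_comp hf hφ, diffAt_congr hcomp, ← diffAt_eq_fderiv, diffAt_comp hψ_symm]
  exact hψ.comp y (hf.comp y hφ)

end Differential

section Form

variable {E : Type*} [NormedAddCommGroup E] [NormedSpace ℂ E]
  {M : Type*} [TopologicalSpace M] [ChartedSpace E M]
  {E' : Type*} [NormedAddCommGroup E'] [NormedSpace ℂ E']
  {N : Type*} [TopologicalSpace N] [ChartedSpace E' N]

/-- The value of a field of bilinear forms at `x`, as a bilinear form on the model space, so that
values at different points can be compared. -/
def formAt (T : BilinField E M) (x : M) : E →L[ℝ] E →L[ℝ] ℝ := T x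

theorem formAt_pullback (f : M → N) (T : BilinField E' N) (x : M) :
    formAt (E := E) (pullback f T) x =
      (formAt T (f x)).bilinearComp (diffAt E E' f x) (diffAt E E' f x) := rfl

theorem formAt_fundamentalForm_apply (T : BilinField E M) (x : M) (v w : E) :
    formAt (fundamentalForm T) x v w = formAt T x (Complex.I • v) w := rfl

/-- The expression of a field of bilinear forms in the chart at `x`. -/
def coordForm (T : BilinField E M) (x : M) (y : E) : E →L[ℝ] E →L[ℝ] ℝ :=
  formAt (pullback (chartAt E x).symm T) y

theorem coordForm_self [IsManifold 𝓘(ℂ, E) ω M] (T : BilinField E M) (x : M) :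
    coordForm T x (chartAt E x x) = formAt T x := by
  have := IsManifold.of_le (I := 𝓘(ℝ, E)) (M := M) (m := 1) (n := ω) (by simp)
  have hd : diffAt E E (chartAt E x).symm (chartAt E x x) = ContinuousLinearMap.id ℝ E := by
    have h := mfderivWithin_range_extChartAt_symm (I := 𝓘(ℝ, E)) (x := x)
    rw [modelWithCornersSelf_coe, Set.range_id, mfderivWithin_univ] at h
    exact h
  rw [coordForm, formAt_pullback, hd, (chartAt E x).left_inv (mem_chart_source E x)]
  rfl

theorem coordForm_smul (c : M → ℝ) (T : BilinField E M) (x : M) :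
    coordForm (fun y => c y • T y) x =
      fun y => (c ∘ (chartAt E x).symm) y • coordForm T x y := rfl

theorem coordForm_congr {T T' : BilinField E M} {x : M} (h : ∀ᶠ y in 𝓝 x, T y = T' y) :
    coordForm T x =ᶠ[𝓝 (chartAt E x x)] coordForm T' x := by
  have hcont : ContinuousAt (chartAt E x).symm (chartAt E x x) :=
    (chartAt E x).continuousAt_symm (mem_chart_target E x)
  rw [← (chartAt E x).left_inv (mem_chart_source E x)] at h
  filter_upwards [hcont.eventually h] with y hy
  rw [coordForm, coordForm, formAt_pullback, formAt_pullback, formAt, formAt, hy]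

theorem coordForm_pullback [IsManifold 𝓘(ℂ, E) ω M] [IsManifold 𝓘(ℂ, E') ω N]
    {f : M → N} {x : M} (hf : ContMDiffAt 𝓘(ℝ, E) 𝓘(ℝ, E') 1 f x) (T : BilinField E' N) :
    let F := writtenInExtChartAt 𝓘(ℝ, E) 𝓘(ℝ, E') x f
    coordForm (E := E) (pullback f T) x =ᶠ[𝓝 (chartAt E x x)]
      fun y => (coordForm T (f x) (F y)).bilinearComp (fderiv ℝ F y) (fderiv ℝ F y) := by
  intro F
  set φ := chartAt E x
  set ψ := chartAt E' (f x)
  have hnear {P : M → Prop} (h : ∀ᶠ z in 𝓝 x, P z) : ∀ᶠ y in 𝓝 (φ x), P (φ.symm y) := by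
    rw [← φ.left_inv (mem_chart_source E x)] at h
    exact (φ.continuousAt_symm (mem_chart_target E x)).eventually h
  have hf_near := (contMDiffAt_iff_contMDiffAt_nhds (by simp)).1 hf
  filter_upwards [hnear hf_near, φ.open_target.mem_nhds (mem_chart_target E x),
    hnear (hf.continuousAt.preimage_mem_nhds (ψ.open_source.mem_nhds (mem_chart_source E' (f x))))]
    with y hfy hy hψy
  have hψF : ψ.symm (F y) = f (φ.symm y) := ψ.left_inv hψy
  have hd := diffAt_comp_diffAt_chartAt_symm hy (hfy.mdifferentiableAt one_ne_zero) hψy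
  calc coordForm (pullback f T) x y
      = (formAt T (f (φ.symm y))).bilinearComp
          ((diffAt E E' f (φ.symm y)).comp (diffAt E E φ.symm y))
          ((diffAt E E' f (φ.symm y)).comp (diffAt E E φ.symm y)) := rfl
    _ = (coordForm T (f x) (F y)).bilinearComp (fderiv ℝ F y) (fderiv ℝ F y) := by
      rw [hd, coordForm, formAt_pullback, hψF]
      rfl

/-- Smoothness at `x` of a field of bilinear forms, expressed in the chart at `x` rather than as
smoothness of a section of a vector bundle. -/
def SmoothFormAt (T : BilinField E M) (x : M) : Prop :=
  ContDiffAt ℝ ∞ (coordForm T x) (chartAt E x x)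

theorem SmoothFormAt.smul {c : M → ℝ} {T : BilinField E M} {x : M}
    (hc : ContMDiffAt 𝓘(ℝ, E) 𝓘(ℝ, ℝ) ∞ c x) (hT : SmoothFormAt T x) :
    SmoothFormAt (fun y => c y • T y) x := by
  rw [SmoothFormAt, coordForm_smul]
  exact ContDiffAt.smul (g := coordForm T x) (contDiffAt_comp_chartAt_symm hc) hT

theorem SmoothFormAt.congr {T T' : BilinField E M} {x : M} (hT : SmoothFormAt T x)
    (h : ∀ᶠ y in 𝓝 x, T y = T' y) : SmoothFormAt T' x :=
  ContDiffAt.congr_of_eventuallyEq hT (coordForm_congr h).symm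

theorem SmoothFormAt.pullback [IsManifold 𝓘(ℂ, E) ω M] [IsManifold 𝓘(ℂ, E') ω N]
    {f : M → N} {x : M} {T : BilinField E' N} (hT : SmoothFormAt T (f x))
    (hf : ContMDiffAt 𝓘(ℝ, E) 𝓘(ℝ, E') ∞ f x) :
    SmoothFormAt (LCK.pullback (E := E) f T) x := by
  have hF := contDiffAt_writtenInExtChartAt hf
  rw [SmoothFormAt, ← writtenInExtChartAt_chartAt_self (E := E)] at hT
  exact (contDiffAt_bilinearComp (ContDiffAt.comp (g := coordForm T (f x)) _ hT hF)
    (hF.fderiv_right (by simp))).congr_of_eventuallyEq (coordForm_pullback (hf.of_le (by simp)) T)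

theorem contMDiffAt_of_smoothFormAt_smul [IsManifold 𝓘(ℂ, E) ω M] {c : M → ℝ}
    {T : BilinField E M} {x : M} (hT : SmoothFormAt T x)
    (hcT : SmoothFormAt (fun y => c y • T y) x) (hne : formAt T x ≠ 0) :
    ContMDiffAt 𝓘(ℝ, E) 𝓘(ℝ, ℝ) ∞ c x := by
  obtain ⟨v, w, hvw⟩ : ∃ v w, formAt T x v w ≠ 0 := by
    by_contra! h
    exact hne (by ext v w; exact h v w)
  set φ := chartAt E x
  rw [← coordForm_self] at hvw
  have happly {S : BilinField E M} (hS : SmoothFormAt S x) :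
      ContDiffAt ℝ ∞ (fun y => coordForm S x y v w) (φ x) :=
    (hS.clm_apply contDiffAt_const).clm_apply contDiffAt_const
  have hφ_smooth : ContMDiffAt 𝓘(ℝ, E) 𝓘(ℝ, E) ∞ φ x :=
    contMDiffAt_of_mem_maximalAtlas (IsManifold.chart_mem_maximalAtlas x) (mem_chart_source E x)
  refine (((happly hcT).div (happly hT) hvw).contMDiffAt.comp x
    hφ_smooth).congr_of_eventuallyEq ?_
  filter_upwards [φ.open_source.mem_nhds (mem_chart_source E x),
    hφ_smooth.continuousAt.eventually ((happly hT).continuousAt.eventually_ne hvw)] with z hz hne_z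
  rw [Function.comp_apply, Pi.div_apply, eq_div_iff hne_z, coordForm_smul]
  exact congrArg (fun z' => c z' * coordForm T x (φ z) v w) (φ.left_inv hz).symm

open Bundle in
theorem inCoordinates_eq_coordForm [IsManifold 𝓘(ℂ, E) ω M] (T : BilinField E M) {x₀ x : M}
    (hx : x ∈ (chartAt E x₀).source) :
    ContinuousLinearMap.inCoordinates E (TangentSpace 𝓘(ℝ, E)) (E →L[ℝ] ℝ)
      (fun x : M ↦ TangentSpace 𝓘(ℝ, E) x →L[ℝ] ℝ) x₀ x x₀ x (T x) =
      coordForm T x₀ (chartAt E x₀ x) := by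
  have hd : ((trivializationAt E (TangentSpace 𝓘(ℝ, E)) x₀).symmL ℝ x : E →L[ℝ] E) =
      diffAt E E (chartAt E x₀).symm (chartAt E x₀ x) := by
    refine (TangentBundle.symmL_trivializationAt (I := 𝓘(ℝ, E)) hx).trans ?_
    simp only [modelWithCornersSelf_coe, Set.range_id, mfderivWithin_univ, extChartAt_coe,
      extChartAt_coe_symm]
    rfl
  ext v w
  rw [inCoordinates_apply_eq₂ (by simpa using hx) (by simpa using hx) (by simp), coordForm,
    formAt_pullback, ← hd, (chartAt E x₀).left_inv hx,
    ← Bundle.Trivialization.symmL_apply (R := ℝ) _ (by simpa using hx),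
    ← Bundle.Trivialization.symmL_apply (R := ℝ) _ (by simpa using hx)]
  simp
  rfl

open Bundle in
theorem contMDiffAt_iff_smoothFormAt [IsManifold 𝓘(ℂ, E) ω M] (T : BilinField E M) (x₀ : M) :
    ContMDiffAt 𝓘(ℝ, E) (𝓘(ℝ, E).prod 𝓘(ℝ, E →L[ℝ] E →L[ℝ] ℝ)) ∞
      (fun b ↦ TotalSpace.mk' (E →L[ℝ] E →L[ℝ] ℝ)
        (E := fun x : M => TangentSpace 𝓘(ℝ, E) x →L[ℝ] TangentSpace 𝓘(ℝ, E) x →L[ℝ] ℝ) b (T b)) x₀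
      ↔ SmoothFormAt T x₀ := by
  set φ := chartAt E x₀
  have hφ : ContMDiffAt 𝓘(ℝ, E) 𝓘(ℝ, E) ∞ φ x₀ :=
    contMDiffAt_of_mem_maximalAtlas (IsManifold.chart_mem_maximalAtlas x₀) (mem_chart_source E x₀)
  have hφ_symm : ContMDiffAt 𝓘(ℝ, E) 𝓘(ℝ, E) ∞ φ.symm (φ x₀) :=
    (contMDiffOn_symm_of_mem_maximalAtlas (IsManifold.chart_mem_maximalAtlas x₀)).contMDiffAt
      (φ.open_target.mem_nhds (mem_chart_target E x₀))
  have hcoord : (fun x => ContinuousLinearMap.inCoordinates E (TangentSpace 𝓘(ℝ, E)) (E →L[ℝ] ℝ)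
      (fun x : M ↦ TangentSpace 𝓘(ℝ, E) x →L[ℝ] ℝ) x₀ x x₀ x (T x)) =ᶠ[𝓝 x₀]
      coordForm T x₀ ∘ φ :=
    Filter.eventually_of_mem (φ.open_source.mem_nhds (mem_chart_source E x₀))
      fun _ => inCoordinates_eq_coordForm T
  refine (contMDiffAt_hom_bundle _).trans ((and_iff_right contMDiffAt_id).trans ?_)
  refine hcoord.contMDiffAt_iff.trans ?_
  rw [SmoothFormAt, ← contMDiffAt_iff_contDiffAt]
  refine ⟨fun h => ?_, fun h => h.comp x₀ hφ⟩
  have hcomp := ContMDiffAt.comp (g := coordForm T x₀ ∘ φ) (φ x₀)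
    (by rwa [φ.left_inv (mem_chart_source E x₀)]) hφ_symm
  refine hcomp.congr_of_eventuallyEq ?_
  filter_upwards [φ.open_target.mem_nhds (mem_chart_target E x₀)] with y hy
  rw [Function.comp_apply, Function.comp_apply, φ.right_inv hy]

theorem extDerivForm_eq_flatExtDeriv (T : BilinField E M) (x : M) (u v w : E) :
    extDerivForm T x u v w = flatExtDeriv (coordForm T x) (chartAt E x x) u v w := rfl

theorem extDerivForm_pullback [IsManifold 𝓘(ℂ, E) ω M] [IsManifold 𝓘(ℂ, E') ω N]
    {f : M → N} {x : M} {T : BilinField E' N} (hT : SmoothFormAt T (f x))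
    (hanti : ∀ a b, formAt T (f x) a b = -formAt T (f x) b a)
    (hf : ContMDiffAt 𝓘(ℝ, E) 𝓘(ℝ, E') ∞ f x) (u v w : E) :
    extDerivForm (pullback (E := E) f T) x u v w =
      extDerivForm T (f x) (diffAt E E' f x u) (diffAt E E' f x v) (diffAt E E' f x w) := by
  rw [SmoothFormAt, ← writtenInExtChartAt_chartAt_self (E := E)] at hT
  rw [← coordForm_self, ← writtenInExtChartAt_chartAt_self (E := E)] at hanti
  rw [extDerivForm_eq_flatExtDeriv, flatExtDeriv_congr (coordForm_pullback (hf.of_le (by simp)) T),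
    flatExtDeriv_bilinearComp_fderiv ((contDiffAt_writtenInExtChartAt hf).of_le (by norm_cast))
      (hT.differentiableAt (by simp)) hanti, writtenInExtChartAt_chartAt_self,
    ← diffAt_eq_fderiv_writtenInExtChartAt (hf.mdifferentiableAt (by simp)),
    extDerivForm_eq_flatExtDeriv]

theorem fundamentalForm_pullback {f : M → N} {x : M}
    (hf : MDifferentiableAt 𝓘(ℂ, E) 𝓘(ℂ, E') f x) (T : BilinField E' N) :
    fundamentalForm (E := E) (pullback f T) x = pullback (E := E) f (fundamentalForm T) x := by
  have h (v w : E) : formAt (E := E) (fundamentalForm (E := E) (pullback f T)) x v w =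
      formAt (E := E) (pullback f (fundamentalForm T)) x v w := by
    simp only [formAt_fundamentalForm_apply, formAt_pullback,
      ContinuousLinearMap.bilinearComp_apply, diffAt_smul hf]
  ext v w
  exact h v w

theorem SmoothFormAt.fundamentalForm [IsManifold 𝓘(ℂ, E) ω M] {T : BilinField E M} {x : M}
    (hT : SmoothFormAt T x) : SmoothFormAt (fundamentalForm T) x := by
  have h : ContDiffAt ℝ ∞ (fun y => (coordForm T x y).comp
      (Complex.I • ContinuousLinearMap.id ℝ E : E →L[ℝ] E)) (chartAt E x x) :=
    ContDiffAt.clm_comp hT contDiffAt_const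
  refine h.congr_of_eventuallyEq ?_
  filter_upwards [(chartAt E x).open_target.mem_nhds (mem_chart_target E x)] with y hy
  have hφ : MDifferentiableAt 𝓘(ℂ, E) 𝓘(ℂ, E) (chartAt E x).symm y :=
    have := IsManifold.of_le (I := 𝓘(ℂ, E)) (M := M) (m := 1) (n := ω) (by simp)
    mdifferentiableAt_atlas_symm (chart_mem_atlas E x) hy
  rw [coordForm, formAt, ← fundamentalForm_pullback hφ T]
  rfl

end Form

/-! ### Kähler metrics and local biholomorphisms -/

section Metric

variable {E : Type*} [NormedAddCommGroup E] [NormedSpace ℂ E]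
  {M : Type*} [TopologicalSpace M] [ChartedSpace E M]
  {E' : Type*} [NormedAddCommGroup E'] [NormedSpace ℂ E']
  {N : Type*} [TopologicalSpace N] [ChartedSpace E' N]

theorem isHermitianForm_pullback {f : M → N} {x : M}
    (hf : IsLocalDiffeomorphAt 𝓘(ℂ, E) 𝓘(ℂ, E') ω f x) {T : BilinField E' N}
    (hT : IsHermitianForm (formAt T (f x))) : IsHermitianForm (formAt (pullback (E := E) f T) x) :=
  hT.bilinearComp (isInvertible_diffAt hf).injective
    (diffAt_smul (hf.contMDiffAt.mdifferentiableAt (by simp)) Complex.I)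

/-- The fundamental form of `T` is closed at `x`. -/
def IsKahlerAt (T : BilinField E M) (x : M) : Prop :=
  ∀ u v w : E, extDerivForm (fundamentalForm T) x u v w = 0

theorem IsKahlerAt.congr {T T' : BilinField E M} {x : M} (hT : IsKahlerAt T x)
    (h : ∀ᶠ y in 𝓝 x, T y = T' y) : IsKahlerAt T' x := by
  have hΩ : ∀ᶠ y in 𝓝 x, fundamentalForm T y = fundamentalForm T' y :=
    h.mono fun y hy => by rw [fundamentalForm, fundamentalForm, hy]
  intro u v w
  rw [extDerivForm_eq_flatExtDeriv, ← flatExtDeriv_congr (coordForm_congr hΩ)]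
  exact hT u v w

theorem ConformalTo.symm {T T' : BilinField E M} (h : ConformalTo T T') :
    ConformalTo T' T := by
  obtain ⟨α, hα, h⟩ := h
  refine ⟨fun x => -α x, hα.neg, fun x => ?_⟩
  rw [h, smul_smul, ← Real.exp_add, neg_add_cancel, Real.exp_zero, one_smul]

theorem ConformalTo.trans {T T' T'' : BilinField E M} (h : ConformalTo T T')
    (h' : ConformalTo T' T'') : ConformalTo T T'' := by
  obtain ⟨α, hα, h⟩ := h
  obtain ⟨β, hβ, h'⟩ := h'
  refine ⟨fun x => β x + α x, hβ.add hα, fun x => ?_⟩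
  rw [h', h, smul_smul, ← Real.exp_add]

theorem ConformalTo.exists_formAt_eq_smul {T T' : BilinField E M} (h : ConformalTo T T') (x : M) :
    ∃ c : ℝ, 0 < c ∧ formAt T' x = c • formAt T x := by
  obtain ⟨α, -, h⟩ := h
  exact ⟨Real.exp (α x), Real.exp_pos _, h x⟩

theorem ConformalTo.pullback {f : M → N} (hf : ContMDiff 𝓘(ℝ, E) 𝓘(ℝ, E') ∞ f)
    {T T' : BilinField E' N} (h : ConformalTo T T') :
    ConformalTo (LCK.pullback (E := E) f T) (LCK.pullback (E := E) f T') := by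
  obtain ⟨α, hα, h⟩ := h
  refine ⟨α ∘ f, hα.comp hf, fun x => ?_⟩
  rw [LCK.pullback, h]
  rfl

variable [IsManifold 𝓘(ℂ, E) ω M]

theorem HermitianMetric.isHermitianForm (g : HermitianMetric E M) (x : M) :
    IsHermitianForm (formAt g.form x) where
  symm := g.symm x
  pos := g.pos x
  map_I_smul := g.hermitian x

theorem HermitianMetric.smoothFormAt (g : HermitianMetric E M) (x : M) : SmoothFormAt g.form x :=
  (contMDiffAt_iff_smoothFormAt _ x).1 (g.contMDiff x)

/-- The Hermitian metric with a given field of scalar products. -/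
def HermitianMetric.ofForm [FiniteDimensional ℂ E] (T : BilinField E M)
    (hT : ∀ x, IsHermitianForm (formAt T x)) (hT_smooth : ∀ x, SmoothFormAt T x) :
    HermitianMetric E M where
  inner := T
  symm x := (hT x).symm
  pos x := (hT x).pos
  isVonNBounded x :=
    haveI : FiniteDimensional ℝ E := FiniteDimensional.complexToReal E
    isVonNBounded_setOf_apply_self_lt_one (B := formAt T x) (hT x).pos
  contMDiff x := (contMDiffAt_iff_smoothFormAt T x).2 (hT_smooth x)
  hermitian x := (hT x).map_I_smul

theorem conformalTo_of_forall_smul {g k : HermitianMetric E M}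
    (h : ∀ x, ∃ c : ℝ, 0 < c ∧ formAt k.form x = c • formAt g.form x) :
    ConformalTo g.form k.form := by
  rcases subsingleton_or_nontrivial E with hE | hE
  · refine ⟨fun _ => 0, contMDiff_const, fun x => ?_⟩
    ext v w
    rw [show v = 0 from Subsingleton.elim (α := E) v 0]
    simp
  choose c hc hck using h
  have hk : k.form = fun x => c x • g.form x := funext hck
  have hc_smooth : ContMDiff 𝓘(ℝ, E) 𝓘(ℝ, ℝ) ∞ c := fun x =>
    contMDiffAt_of_smoothFormAt_smul (g.smoothFormAt x) (hk ▸ k.smoothFormAt x)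
      (g.isHermitianForm x).ne_zero
  refine ⟨fun x => Real.log (c x), fun x => ?_, fun x => ?_⟩
  · exact (Real.contDiffAt_log.2 (hc x).ne').contMDiffAt.comp x (hc_smooth x)
  · rw [Real.exp_log (hc x)]
    exact hck x

theorem ConformalTo.of_pullback {f : N → M} (hf : IsLocalDiffeomorph 𝓘(ℂ, E') 𝓘(ℂ, E) ω f)
    (hf_surj : Function.Surjective f) {g k : HermitianMetric E M}
    (h : ConformalTo (LCK.pullback (E := E') f g.form) (LCK.pullback (E := E') f k.form)) :
    ConformalTo g.form k.form := by
  refine conformalTo_of_forall_smul (hf_surj.forall.2 fun x => ?_)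
  obtain ⟨c, hc, hx⟩ := h.exists_formAt_eq_smul x
  refine ⟨c, hc, bilinearComp_injective (isInvertible_diffAt (hf x)).surjective ?_⟩
  exact hx

theorem HermitianMetric.IsLCK.of_conformalTo {g k : HermitianMetric E M} (hg : g.IsLCK)
    (h : ConformalTo g.form k.form) : k.IsLCK := by
  obtain ⟨β, hβ, hk⟩ := h
  intro x₀
  obtain ⟨U, hU, hx₀, α, hα, hαg⟩ := hg x₀
  refine ⟨U, hU, hx₀, fun x => α x - β x, hα.sub hβ.contMDiffOn, fun x hx => ?_⟩
  have hform : (fun y => Real.exp (α y - β y) • k.form y) = fun y => Real.exp (α y) • g.form y := by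
    funext y
    rw [hk, smul_smul, ← Real.exp_add, sub_add_cancel]
  rw [hform]
  exact hαg x hx

theorem HermitianMetric.IsGCK.isLCK {g : HermitianMetric E M} (hg : g.IsGCK) : g.IsLCK := by
  obtain ⟨k, hk, α, hα, hgk⟩ := hg
  refine fun x₀ => ⟨Set.univ, isOpen_univ, Set.mem_univ x₀, α, hα.contMDiffOn, fun x _ => ?_⟩
  rw [← funext hgk]
  exact hk x

variable [IsManifold 𝓘(ℂ, E') ω N]

theorem smoothFormAt_pullback {f : M → N} {x : M}
    (hf : IsLocalDiffeomorphAt 𝓘(ℂ, E) 𝓘(ℂ, E') ω f x) {T : BilinField E' N}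
    (hT : SmoothFormAt T (f x)) : SmoothFormAt (pullback (E := E) f T) x :=
  hT.pullback ((contMDiffAt_real hf.contMDiffAt).of_le (by simp))

/-- The pull-back of a Hermitian metric by a local biholomorphism. -/
def HermitianMetric.pullback [FiniteDimensional ℂ E] (g : HermitianMetric E' N) (f : M → N)
    (hf : IsLocalDiffeomorph 𝓘(ℂ, E) 𝓘(ℂ, E') ω f) : HermitianMetric E M :=
  ofForm (LCK.pullback f g.form) (fun x => isHermitianForm_pullback (hf x) (g.isHermitianForm _))
    fun x => smoothFormAt_pullback (hf x) (g.smoothFormAt _)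

theorem isKahlerAt_pullback_iff {f : M → N} {x : M}
    (hf : IsLocalDiffeomorphAt 𝓘(ℂ, E) 𝓘(ℂ, E') ω f x) {T : BilinField E' N}
    (hT : SmoothFormAt T (f x)) (hT_herm : IsHermitianForm (formAt T (f x))) :
    IsKahlerAt (pullback (E := E) f T) x ↔ IsKahlerAt T (f x) := by
  have hΩ : ∀ᶠ y in 𝓝 x, fundamentalForm (pullback (E := E) f T) y =
      pullback (E := E) f (fundamentalForm T) y :=
    ((contMDiffAt_iff_contMDiffAt_nhds (by simp)).1 hf.contMDiffAt).mono fun y hy =>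
      fundamentalForm_pullback (hy.mdifferentiableAt (by simp)) T
  have hd (u v w : E) : extDerivForm (fundamentalForm (pullback (E := E) f T)) x u v w =
      extDerivForm (fundamentalForm T) (f x) (diffAt E E' f x u) (diffAt E E' f x v)
        (diffAt E E' f x w) := by
    rw [← extDerivForm_pullback hT.fundamentalForm hT_herm.apply_I_smul_antisymm
      ((contMDiffAt_real hf.contMDiffAt).of_le (by simp)), extDerivForm_eq_flatExtDeriv,
      flatExtDeriv_congr (coordForm_congr hΩ), extDerivForm_eq_flatExtDeriv]
  have hsurj := (isInvertible_diffAt hf).surjective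
  simp only [IsKahlerAt, hd, hsurj.forall]

theorem HermitianMetric.isKahler_pullback_iff [FiniteDimensional ℂ E] (g : HermitianMetric E' N)
    {f : M → N} (hf : IsLocalDiffeomorph 𝓘(ℂ, E) 𝓘(ℂ, E') ω f) (hf_surj : Function.Surjective f) :
    (g.pullback f hf).IsKahler ↔ g.IsKahler := by
  have h (x : M) : IsKahlerAt (LCK.pullback (E := E) f g.form) x ↔ IsKahlerAt g.form (f x) :=
    isKahlerAt_pullback_iff (hf x) (g.smoothFormAt _) (g.isHermitianForm _)
  exact (forall_congr' h).trans hf_surj.forall.symm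

theorem HermitianMetric.IsLCK.of_pullback [FiniteDimensional ℂ E] {g : HermitianMetric E' N}
    {f : M → N} (hf : IsLocalDiffeomorph 𝓘(ℂ, E) 𝓘(ℂ, E') ω f) (hf_surj : Function.Surjective f)
    (h : (g.pullback f hf).IsLCK) : g.IsLCK := by
  refine hf_surj.forall.2 fun x₀ => ?_
  obtain ⟨U, hU, hx₀, α, hα, hαg⟩ := h x₀
  set σ := (hf x₀).localInverse
  have hσ {q : N} (hq : q ∈ σ.source) : f (σ q) = q := (hf x₀).localInverse_right_inv hq
  have hσ_smooth : ContMDiffOn 𝓘(ℝ, E') 𝓘(ℝ, E) ∞ σ σ.source := fun q hq =>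
    (contMDiffWithinAt_real ((hf x₀).localInverse_contMDiffOn q hq)).of_le (by simp)
  refine ⟨σ.source ∩ σ ⁻¹' U, hσ_smooth.continuousOn.isOpen_inter_preimage σ.open_source hU,
    ⟨(hf x₀).localInverse_mem_source, ?_⟩, α ∘ σ,
    hα.comp (hσ_smooth.mono Set.inter_subset_left) Set.inter_subset_right, fun q hq => ?_⟩
  · rwa [Set.mem_preimage, (hf x₀).localInverse_left_inv (hf x₀).localInverse_mem_target]
  obtain ⟨hqσ, hqU⟩ := hq
  have hασ : ContMDiffAt 𝓘(ℝ, E') 𝓘(ℝ, ℝ) ∞ (fun y => Real.exp ((α ∘ σ) y)) q :=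
    Real.contDiff_exp.contMDiff.contMDiffAt.comp q ((hα.contMDiffAt (hU.mem_nhds hqU)).comp q
      (hσ_smooth.contMDiffAt (σ.open_source.mem_nhds hqσ)))
  have hiff := isKahlerAt_pullback_iff (x := σ q) (hf (σ q))
    (T := fun y => Real.exp ((α ∘ σ) y) • g.form y)
  rw [hσ hqσ] at hiff
  refine (hiff ((g.smoothFormAt q).smul hασ)
    ((g.isHermitianForm q).smul (Real.exp_pos _))).1 (IsKahlerAt.congr (hαg (σ q) hqU) ?_)
  filter_upwards [σ.open_target.mem_nhds (σ.map_source hqσ)] with y hy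
  have hσf : σ (f y) = y := (hf x₀).localInverse_left_inv hy
  rw [LCK.pullback, Function.comp_apply, hσf]
  rfl

end Metric

section Homothety

theorem isLocallyConstant_of_mfderiv_eq_zero {E : Type*} [NormedAddCommGroup E] [NormedSpace ℝ E]
    {M : Type*} [TopologicalSpace M] [ChartedSpace E M] [IsManifold 𝓘(ℝ, E) 1 M]
    {F : Type*} [NormedAddCommGroup F] [NormedSpace ℝ F] {h : M → F}
    (hh : MDifferentiable 𝓘(ℝ, E) 𝓘(ℝ, F) h) (h_zero : ∀ x, mfderiv 𝓘(ℝ, E) 𝓘(ℝ, F) h x = 0) :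
    IsLocallyConstant h := by
  rw [IsLocallyConstant.iff_eventually_eq]
  intro x
  set φ := chartAt E x
  have hd (y : E) (hy : y ∈ φ.target) : HasFDerivAt (h ∘ φ.symm) (0 : E →L[ℝ] F) y := by
    have hcomp := (hh (φ.symm y)).hasMFDerivAt.comp y
      (mdifferentiableAt_atlas_symm (chart_mem_atlas E x) hy).hasMFDerivAt
    rw [h_zero, ContinuousLinearMap.zero_comp] at hcomp
    exact hcomp.hasFDerivAt
  have hopen := φ.open_target.isOpen_inter_preimage_of_fderiv_eq_zero
    (fun y hy => (hd y hy).differentiableAt.differentiableWithinAt) (fun y hy => (hd y hy).fderiv)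
    {h x}
  have hmem : φ x ∈ φ.target ∩ h ∘ φ.symm ⁻¹' {h x} :=
    ⟨mem_chart_target E x, congrArg h (φ.left_inv (mem_chart_source E x))⟩
  filter_upwards [φ.open_source.mem_nhds (mem_chart_source E x),
    (φ.continuousAt (mem_chart_source E x)).preimage_mem_nhds (hopen.mem_nhds hmem)] with z hz hz'
  exact (congrArg h (φ.left_inv hz)).symm.trans hz'.2

variable {E : Type*} [NormedAddCommGroup E] [NormedSpace ℂ E] [FiniteDimensional ℂ E]
  {M : Type*} [TopologicalSpace M] [ChartedSpace E M] [IsManifold 𝓘(ℂ, E) ω M]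

theorem mfderiv_eq_zero_of_isKahlerAt_smul (hE : 2 ≤ Module.finrank ℂ E) {T : BilinField E M}
    {c : M → ℝ} {x : M} (hT : SmoothFormAt T x) (hT_herm : IsHermitianForm (formAt T x))
    (hc : MDifferentiableAt 𝓘(ℝ, E) 𝓘(ℝ, ℝ) c x) (hT_kahler : IsKahlerAt T x)
    (hcT_kahler : IsKahlerAt (fun y => c y • T y) x) : mfderiv 𝓘(ℝ, E) 𝓘(ℝ, ℝ) c x = 0 := by
  have hc_diff : DifferentiableAt ℝ (c ∘ (chartAt E x).symm) (chartAt E x x) := by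
    simpa [DifferentiableWithinAtProp, differentiableWithinAt_univ, chartAt_self_eq] using hc.2
  have hmfderiv : mfderiv 𝓘(ℝ, E) 𝓘(ℝ, ℝ) c x =
      fderiv ℝ (c ∘ (chartAt E x).symm) (chartAt E x x) := by
    refine hc.mfderiv.trans ?_
    rw [modelWithCornersSelf_coe, Set.range_id, fderivWithin_univ]
    rfl
  rw [hmfderiv]
  refine hT_herm.eq_zero_of_wedge_eq_zero hE fun u v w => ?_
  have hd := flatExtDeriv_smul hc_diff (hT.fundamentalForm.differentiableAt (by simp)) u v w
  rw [← extDerivForm_eq_flatExtDeriv, hT_kahler, mul_zero, zero_add, coordForm_self] at hd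
  exact hd.symm.trans (hcT_kahler u v w)

theorem HermitianMetric.IsKahler.exists_smul_eq_of_conformalTo (hE : 2 ≤ Module.finrank ℂ E)
    [PreconnectedSpace M] {g k : HermitianMetric E M} (hg : g.IsKahler) (hk : k.IsKahler)
    (h : ConformalTo g.form k.form) :
    ∃ c : ℝ, 0 < c ∧ ∀ x, formAt k.form x = c • formAt g.form x := by
  obtain ⟨α, hα, hk_eq⟩ := h
  rcases isEmpty_or_nonempty M with hM | ⟨⟨x₀⟩⟩
  · exact ⟨1, one_pos, fun x => isEmptyElim x⟩
  have hexp : MDifferentiable 𝓘(ℝ, E) 𝓘(ℝ, ℝ) fun x => Real.exp (α x) :=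
    (Real.contDiff_exp.contMDiff.comp hα).mdifferentiable (by simp)
  have := IsManifold.of_le (I := 𝓘(ℝ, E)) (M := M) (m := 1) (n := ω) (by simp)
  have hconst := isLocallyConstant_of_mfderiv_eq_zero hexp fun x =>
    mfderiv_eq_zero_of_isKahlerAt_smul hE (g.smoothFormAt x) (g.isHermitianForm x) (hexp x) (hg x)
      (funext hk_eq ▸ hk x : IsKahlerAt (fun y => Real.exp (α y) • g.form y) x)
  refine ⟨Real.exp (α x₀), Real.exp_pos _, fun x => ?_⟩
  rw [← hconst.apply_eq_of_preconnectedSpace x x₀]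
  exact hk_eq x

end Homothety

/-! ### Descent along a surjective local biholomorphism -/

section Descent

variable {E : Type*} [NormedAddCommGroup E] [NormedSpace ℂ E]
  {M : Type*} [TopologicalSpace M] [ChartedSpace E M]
  {E' : Type*} [NormedAddCommGroup E'] [NormedSpace ℂ E']
  {N : Type*} [TopologicalSpace N] [ChartedSpace E' N]

variable (E') in
/-- The value of `T` at `x`, transported to the tangent space at `f x` by the differential of `f`.
It is `0`, with no meaning, where that differential is not invertible. -/
def pushforwardAt (f : M → N) (T : BilinField E M) (x : M) : E' →L[ℝ] E' →L[ℝ] ℝ :=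
  (formAt T x).bilinearComp (diffAt E E' f x).inverse (diffAt E E' f x).inverse

theorem pushforwardAt_eq_iff {f : M → N} {x : M} (hf : (diffAt E E' f x).IsInvertible)
    {T : BilinField E M} {B : E' →L[ℝ] E' →L[ℝ] ℝ} : pushforwardAt E' f T x = B ↔
      formAt T x = B.bilinearComp (diffAt E E' f x) (diffAt E E' f x) := by
  refine ⟨fun h => ?_, fun h => ?_⟩
  · ext v w
    simp [← h, pushforwardAt, hf.inverse_apply_self]
  · ext v w
    simp [h, pushforwardAt, hf.self_apply_inverse]

theorem pushforwardAt_eq_smul_iff {f : M → N} {x : M} (hf : (diffAt E E' f x).IsInvertible)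
    {S T : BilinField E M} {c : ℝ} :
    pushforwardAt E' f T x = c • pushforwardAt E' f S x ↔ formAt T x = c • formAt S x := by
  have hS := (pushforwardAt_eq_iff hf (T := S)).1 rfl
  rw [pushforwardAt_eq_iff hf, hS]
  rfl

theorem pushforwardAt_pullback_of_comp_eq {f : M → N} {φ : M → M} (hfφ : f ∘ φ = f) {x : M}
    (hf : (diffAt E E' f x).IsInvertible) (hf_diff : MDifferentiableAt 𝓘(ℝ, E) 𝓘(ℝ, E') f (φ x))
    (hf_inv : (diffAt E E' f (φ x)).IsInvertible)
    (hφ : MDifferentiableAt 𝓘(ℝ, E) 𝓘(ℝ, E) φ x) (T : BilinField E M) :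
    pushforwardAt E' f (pullback (E := E) φ T) x = pushforwardAt E' f T (φ x) := by
  have hT := (pushforwardAt_eq_iff hf_inv (T := T)).1 rfl
  have hd : diffAt E E' f x = (diffAt E E' f (φ x)).comp (diffAt E E φ x) := by
    rw [← diffAt_comp hf_diff hφ, hfφ]
  rw [pushforwardAt_eq_iff hf, formAt_pullback, hT, hd]
  rfl

variable (E') in
/-- The transports of `T` to `N` from two points with the same image agree: a section of the bundle
of bilinear forms on `N` is well defined by them. -/
def FiberInvariant (f : M → N) (T : BilinField E M) : Prop :=
  ∀ x y, f x = f y → pushforwardAt E' f T x = pushforwardAt E' f T y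

variable (E') in
/-- The transports of `T` to `N` from two points with the same image are positive multiples of each
other. -/
def FiberConformal (f : M → N) (T : BilinField E M) : Prop :=
  ∀ x y, f x = f y → ∃ c : ℝ, 0 < c ∧ pushforwardAt E' f T x = c • pushforwardAt E' f T y

/-- The bilinear forms at `q` that are positive multiples of the transports of `T` from all points
of the fibre over `q`. -/
def descentCone (f : M → N) (T : BilinField E M) (q : N) : Set (E' →L[ℝ] E' →L[ℝ] ℝ) :=
  ⋂ x ∈ f ⁻¹' {q}, (fun c : ℝ => c • pushforwardAt E' f T x) '' Set.Ioi 0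

theorem convex_descentCone (f : M → N) (T : BilinField E M) (q : N) :
    Convex ℝ (descentCone (E' := E') f T q) :=
  convex_iInter₂ fun x _ =>
    (convex_Ioi 0).linear_image (LinearMap.toSpanSingleton ℝ _ (pushforwardAt E' f T x))

theorem isHermitianForm_pushforwardAt {f : M → N} {x : M}
    (hf : IsLocalDiffeomorphAt 𝓘(ℂ, E) 𝓘(ℂ, E') ω f x) {T : BilinField E M}
    (hT : IsHermitianForm (formAt T x)) : IsHermitianForm (pushforwardAt E' f T x) := by
  have hinv := isInvertible_diffAt hf
  refine hT.bilinearComp hinv.inverse.injective fun v => hinv.injective ?_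
  rw [diffAt_smul (hf.contMDiffAt.mdifferentiableAt (by simp)), hinv.self_apply_inverse,
    hinv.self_apply_inverse]

theorem formAt_pullback_localInverse {f : M → N} (hf : IsLocalDiffeomorph 𝓘(ℂ, E) 𝓘(ℂ, E') ω f)
    {x₀ : M} {q : N} (hq : q ∈ (hf x₀).localInverse.source) (T : BilinField E M) :
    formAt (E := E') (pullback (hf x₀).localInverse T) q =
      pushforwardAt E' f T ((hf x₀).localInverse q) := by
  set σ := (hf x₀).localInverse
  have hfσ : f (σ q) = q := (hf x₀).localInverse_right_inv hq
  have hσ : MDifferentiableAt 𝓘(ℝ, E') 𝓘(ℝ, E) σ (f (σ q)) := by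
    rw [hfσ]
    exact (contMDiffAt_real ((hf x₀).localInverse_contMDiffOn.contMDiffAt
      (σ.open_source.mem_nhds hq))).mdifferentiableAt (by simp)
  have hσf : σ ∘ f =ᶠ[𝓝 (σ q)] id :=
    Filter.eventually_of_mem (σ.open_target.mem_nhds (σ.map_source hq)) fun y hy =>
      (hf x₀).localInverse_left_inv hy
  have hid : (diffAt E' E σ q).comp (diffAt E E' f (σ q)) = ContinuousLinearMap.id ℝ E := by
    have hd := diffAt_comp hσ
      ((contMDiffAt_real (hf (σ q)).contMDiffAt).mdifferentiableAt (by simp))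
    rw [diffAt_congr hσf, hfσ] at hd
    exact hd.symm.trans mfderiv_id
  symm
  rw [pushforwardAt_eq_iff (isInvertible_diffAt (hf (σ q))), formAt_pullback]
  exact congrArg (fun A => (formAt T (σ q)).bilinearComp A A) hid.symm

variable [IsManifold 𝓘(ℂ, E) ω M] [IsManifold 𝓘(ℂ, E') ω N]

theorem smoothFormAt_pullback_localInverse {f : M → N}
    (hf : IsLocalDiffeomorph 𝓘(ℂ, E) 𝓘(ℂ, E') ω f) {x₀ : M} {q : N}
    (hq : q ∈ (hf x₀).localInverse.source) {T : BilinField E M}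
    (hT : SmoothFormAt T ((hf x₀).localInverse q)) :
    SmoothFormAt (pullback (E := E') (hf x₀).localInverse T) q :=
  hT.pullback ((contMDiffAt_real ((hf x₀).localInverse_contMDiffOn.contMDiffAt
    ((hf x₀).localInverse.open_source.mem_nhds hq))).of_le (by simp))

theorem exists_pullback_form_eq [FiniteDimensional ℂ E'] {f : M → N}
    (hf : IsLocalDiffeomorph 𝓘(ℂ, E) 𝓘(ℂ, E') ω f) (hf_surj : Function.Surjective f)
    {g : HermitianMetric E M} (hg : FiberInvariant E' f g.form) :
    ∃ h : HermitianMetric E' N, pullback f h.form = g.form := by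
  let T : BilinField E' N := fun q => pushforwardAt E' f g.form (Function.surjInv hf_surj q)
  have hT (x : M) : formAt T (f x) = pushforwardAt E' f g.form x :=
    hg _ _ (Function.surjInv_eq hf_surj _)
  refine ⟨.ofForm T (hf_surj.forall.2 fun x => ?_) (hf_surj.forall.2 fun x₀ => ?_),
    funext fun x => ?_⟩
  · rw [hT]
    exact isHermitianForm_pushforwardAt (hf x) (g.isHermitianForm x)
  · set σ := (hf x₀).localInverse
    have hx₀ : f x₀ ∈ σ.source := (hf x₀).localInverse_mem_source
    refine (smoothFormAt_pullback_localInverse hf hx₀ (g.smoothFormAt _)).congr ?_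
    filter_upwards [σ.open_source.mem_nhds hx₀] with q hq
    have hfσ : f (σ q) = q := (hf x₀).localInverse_right_inv hq
    have hTq := hT (σ q)
    rw [hfσ, ← formAt_pullback_localInverse hf hq] at hTq
    exact hTq.symm
  · exact ((pushforwardAt_eq_iff (isInvertible_diffAt (hf x))).1 (hT x).symm).symm

set_option synthInstance.maxHeartbeats 200000 in
-- Instances on the bundle of bilinear forms are found only after a long search.
theorem exists_smoothForm_forall_mem_convex [FiniteDimensional ℝ E] [T2Space M]
    [SigmaCompactSpace M] (t : M → Set (E →L[ℝ] E →L[ℝ] ℝ)) (ht : ∀ x, Convex ℝ (t x))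
    (hloc : ∀ x, ∃ U ∈ 𝓝 x, ∃ S : BilinField E M, ∀ y ∈ U, SmoothFormAt S y ∧ formAt S y ∈ t y) :
    ∃ T : BilinField E M, ∀ x, SmoothFormAt T x ∧ formAt T x ∈ t x := by
  let t' (x : M) : Set (TangentSpace 𝓘(ℝ, E) x →L[ℝ] TangentSpace 𝓘(ℝ, E) x →L[ℝ] ℝ) := t x
  have ht' (x : M) : Convex ℝ (t' x) := ht x
  obtain ⟨s, hs⟩ := exists_contMDiffSection_forall_mem_convex_of_local (E := E) (M := M) 𝓘(ℝ, E)
    (n := ⊤) (F_fiber := E →L[ℝ] E →L[ℝ] ℝ)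
    (fun x : M => TangentSpace 𝓘(ℝ, E) x →L[ℝ] TangentSpace 𝓘(ℝ, E) x →L[ℝ] ℝ) t' ht' (fun x => by
      obtain ⟨U, hU, S, hS⟩ := hloc x
      exact ⟨U, hU, S, fun y hy =>
        ((contMDiffAt_iff_smoothFormAt S y).2 (hS y hy).1).contMDiffWithinAt,
        fun y hy => (hS y hy).2⟩)
  exact ⟨fun x => s x, fun x =>
    ⟨(contMDiffAt_iff_smoothFormAt (fun x => s x) x).1 s.contMDiff.contMDiffAt, hs x⟩⟩

theorem exists_conformalTo_pullback [FiniteDimensional ℂ E] [FiniteDimensional ℂ E'] [T2Space N]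
    [SigmaCompactSpace N] {f : M → N} (hf : IsLocalDiffeomorph 𝓘(ℂ, E) 𝓘(ℂ, E') ω f)
    (hf_surj : Function.Surjective f) {g : HermitianMetric E M}
    (hg : FiberConformal E' f g.form) :
    ∃ h : HermitianMetric E' N, ConformalTo (pullback f h.form) g.form := by
  have : FiniteDimensional ℝ E' := FiniteDimensional.complexToReal E'
  obtain ⟨T, hT⟩ := exists_smoothForm_forall_mem_convex (descentCone (E' := E') f g.form)
    (convex_descentCone f g.form) <| hf_surj.forall.2 fun x₀ => by
      set σ := (hf x₀).localInverse
      refine ⟨σ.source, σ.open_source.mem_nhds (hf x₀).localInverse_mem_source,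
        pullback σ g.form, fun q hq =>
          ⟨smoothFormAt_pullback_localInverse hf hq (g.smoothFormAt _),
            Set.mem_iInter₂.2 fun x hx => ?_⟩⟩
      have hfσ : f (σ q) = q := (hf x₀).localInverse_right_inv hq
      obtain ⟨c, hc, h⟩ := hg (σ q) x (hfσ.trans hx.symm)
      exact ⟨c, hc, h.symm.trans (formAt_pullback_localInverse hf hq g.form).symm⟩
  have hT_push (x : M) : ∃ c : ℝ, 0 < c ∧ c • pushforwardAt E' f g.form x = formAt T (f x) :=
    Set.mem_iInter₂.1 (hT (f x)).2 x rfl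
  refine ⟨.ofForm T (hf_surj.forall.2 fun x => ?_) fun q => (hT q).1, ?_⟩
  · obtain ⟨c, hc, h⟩ := hT_push x
    exact h ▸ (isHermitianForm_pushforwardAt (hf x) (g.isHermitianForm x)).smul hc
  · refine ConformalTo.symm (conformalTo_of_forall_smul
      (k := HermitianMetric.pullback (.ofForm T _ _) f hf) fun x => ?_)
    obtain ⟨c, hc, h⟩ := hT_push x
    refine ⟨c, hc, ?_⟩
    rw [(pushforwardAt_eq_iff (isInvertible_diffAt (hf x)) (T := g.form)).1 rfl]
    exact congrArg (fun B => B.bilinearComp (diffAt E E' f x) (diffAt E E' f x)) h.symm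

theorem isGCK_of_fiberInvariant [FiniteDimensional ℂ E] [FiniteDimensional ℂ E'] {f : M → N}
    (hf : IsLocalDiffeomorph 𝓘(ℂ, E) 𝓘(ℂ, E') ω f) (hf_surj : Function.Surjective f)
    {g : HermitianMetric E' N} {k : HermitianMetric E M} (hk : k.IsKahler)
    (hgk : ConformalTo (pullback f g.form) k.form) (hk_inv : FiberInvariant E' f k.form) :
    g.IsGCK := by
  obtain ⟨h, hh⟩ := exists_pullback_form_eq hf hf_surj hk_inv
  refine ⟨h, (h.isKahler_pullback_iff hf hf_surj).1 fun x => ?_,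
    .of_pullback hf hf_surj (hh ▸ hgk)⟩
  exact (hh ▸ hk x : IsKahlerAt (pullback f h.form) x)

theorem fiberInvariant_of_isGCK [FiniteDimensional ℂ E] (hE : 2 ≤ Module.finrank ℂ E)
    [PreconnectedSpace M] {f : M → N} (hf : IsLocalDiffeomorph 𝓘(ℂ, E) 𝓘(ℂ, E') ω f)
    (hf_surj : Function.Surjective f) {g : HermitianMetric E' N} {k : HermitianMetric E M}
    (hk : k.IsKahler) (hgk : ConformalTo (pullback f g.form) k.form) (hg : g.IsGCK) :
    FiberInvariant E' f k.form := by
  obtain ⟨h, hh, hgh⟩ := hg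
  have hhk : ConformalTo (h.pullback f hf).form k.form :=
    (hgh.pullback fun x => (contMDiffAt_real (hf x).contMDiffAt).of_le (by simp)).symm.trans hgk
  obtain ⟨c, -, hc⟩ :=
    ((h.isKahler_pullback_iff hf hf_surj).2 hh).exists_smul_eq_of_conformalTo hE hk hhk
  have hpush (x : M) : pushforwardAt E' f k.form x = c • formAt h.form (f x) :=
    (pushforwardAt_eq_iff (isInvertible_diffAt (hf x))).2 (hc x)
  intro x y hxy
  rw [hpush, hpush, hxy]

end Descent

/-! ### The projection onto the quotient -/

section Quotient

theorem isLocalDiffeomorphAt_of_eqOn_trans_symm {𝕜 : Type*} [NontriviallyNormedField 𝕜]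
    {E : Type*} [NormedAddCommGroup E] [NormedSpace 𝕜 E]
    {H : Type*} [TopologicalSpace H] {I : ModelWithCorners 𝕜 E H} {n : WithTop ℕ∞}
    {M : Type*} [TopologicalSpace M] [ChartedSpace H M]
    {N : Type*} [TopologicalSpace N] [ChartedSpace H N]
    {φ : OpenPartialHomeomorph M H} (hφ : φ ∈ IsManifold.maximalAtlas I n M)
    {ψ : OpenPartialHomeomorph N H} (hψ : ψ ∈ IsManifold.maximalAtlas I n N)
    {f : M → N} {x : M} (hf : Set.EqOn f (φ.trans ψ.symm) (φ.trans ψ.symm).source)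
    (hx : x ∈ (φ.trans ψ.symm).source) : IsLocalDiffeomorphAt I I n f x := by
  refine ⟨⟨(φ.trans ψ.symm).toPartialEquiv, (φ.trans ψ.symm).open_source,
    (φ.trans ψ.symm).open_target, ?_, ?_⟩, hx, hf⟩
  · exact (contMDiffOn_symm_of_mem_maximalAtlas hψ).comp
      ((contMDiffOn_of_mem_maximalAtlas hφ).mono fun y hy => hy.1) fun y hy => hy.2
  · exact (contMDiffOn_symm_of_mem_maximalAtlas hφ).comp
      ((contMDiffOn_of_mem_maximalAtlas hψ).mono fun y hy => hy.1) fun y hy => hy.2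

variable {E : Type*} [NormedAddCommGroup E] [NormedSpace ℂ E]
  {M : Type*} [TopologicalSpace M] [ChartedSpace E M]

theorem HermitianMetric.IsHomothety.dilationFactor_eq_one_iff [IsManifold 𝓘(ℂ, E) ω M]
    [Nonempty M] [Nontrivial E] {k : HermitianMetric E M} {γ : Biholomorphism E M}
    (hγ : k.IsHomothety γ) : k.dilationFactor γ = 1 ↔ k.HasDilationFactor γ 1 := by
  refine ⟨fun h => ?_, fun h => h.dilationFactor_eq⟩
  obtain ⟨c, hc⟩ := hγ
  rwa [hc.dilationFactor_eq.symm.trans h] at hc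

theorem proj_surjective (Γ : Subgroup (Biholomorphism E M)) : Function.Surjective (proj Γ) :=
  Quotient.mk_surjective

variable {Γ : Subgroup (Biholomorphism E M)}

theorem proj_comp {γ : Biholomorphism E M} (hγ : γ ∈ Γ) : proj Γ ∘ γ = proj Γ :=
  funext fun _ => Quotient.sound ⟨⟨γ, hγ⟩, rfl⟩

theorem proj_eq_iff {x y : M} : proj Γ x = proj Γ y ↔ ∃ γ ∈ Γ, γ x = y := by
  refine ⟨fun h => ?_, ?_⟩
  · obtain ⟨γ, hγ⟩ := Quotient.exact h.symm
    exact ⟨γ.1, γ.2, hγ⟩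
  · rintro ⟨γ, hγ, rfl⟩
    exact (congrFun (proj_comp hγ) x).symm

variable [FiniteDimensional ℂ E] [T2Space M] [IsCancelSMul Γ M] [ProperlyDiscontinuousSMul Γ M]
  [IsManifold 𝓘(ℂ, E) ω M]

variable (Γ) in
theorem isLocalDiffeomorph_proj : IsLocalDiffeomorph 𝓘(ℂ, E) 𝓘(ℂ, E) ω (proj Γ) := by
  intro x
  set q := proj Γ x
  obtain ⟨a, ha⟩ := exists_chart_eq Γ (chart_mem_atlas E q)
  set σ := (isLocalHomeomorph_proj Γ).localInverseAt a
  have hσ_symm : ⇑σ.symm = proj Γ := (isLocalHomeomorph_proj Γ).localInverseAt_symm a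
  obtain ⟨hqσ, hσq⟩ : q ∈ σ.source ∧ σ q ∈ (chartAt E a).source := by
    simpa [ha] using mem_chart_source E q
  have hlocal : IsLocalDiffeomorphAt 𝓘(ℂ, E) 𝓘(ℂ, E) ω (proj Γ) (σ q) := by
    refine isLocalDiffeomorphAt_of_eqOn_trans_symm (IsManifold.chart_mem_maximalAtlas a)
      (IsManifold.chart_mem_maximalAtlas q) (fun y hy => ?_) ⟨hσq, ?_⟩
    · simp [ha, (chartAt E a).left_inv hy.1, hσ_symm]
    · simpa [ha, hσq] using σ.map_source hqσ
  -- `σ q` need not be `x`, but an element of the group carries `x` to it.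
  have hσq_eq : proj Γ (σ q) = q := hσ_symm ▸ σ.left_inv hqσ
  obtain ⟨γ, hγ, hγx⟩ := proj_eq_iff.1 hσq_eq.symm
  rw [← proj_comp hγ]
  exact (γ.isLocalDiffeomorph x).comp _ _ (hγx ▸ hlocal)

theorem pushforwardAt_proj_apply {γ : Biholomorphism E M} (hγ : γ ∈ Γ) (T : BilinField E M)
    (x : M) : pushforwardAt E (proj Γ) T (γ x) =
      pushforwardAt E (proj Γ) (pullback (E := E) γ T) x :=
  have hproj := isLocalDiffeomorph_proj Γ
  (pushforwardAt_pullback_of_comp_eq (proj_comp hγ) (isInvertible_diffAt (hproj x))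
    ((contMDiffAt_real (hproj (γ x)).contMDiffAt).mdifferentiableAt (by simp))
    (isInvertible_diffAt (hproj (γ x)))
    ((contMDiffAt_real γ.contMDiff.contMDiffAt).mdifferentiableAt (by simp)) T).symm

theorem fiberConformal_proj {g : HermitianMetric E M} (hg : ∀ γ ∈ Γ, g.IsAutomorphism γ) :
    FiberConformal E (proj Γ) g.form := by
  intro x y hxy
  obtain ⟨γ, hγ, rfl⟩ := proj_eq_iff.1 hxy
  obtain ⟨c, hc, h⟩ := (hg γ hγ).exists_formAt_eq_smul x
  refine ⟨c, hc, ?_⟩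
  rw [pushforwardAt_proj_apply hγ]
  exact (pushforwardAt_eq_smul_iff (isInvertible_diffAt (isLocalDiffeomorph_proj Γ x))).2 h

theorem fiberInvariant_proj_iff {k : HermitianMetric E M} :
    FiberInvariant E (proj Γ) k.form ↔ ∀ γ ∈ Γ, k.HasDilationFactor γ 1 := by
  have h (γ) (hγ : γ ∈ Γ) (x : M) :
      pushforwardAt E (proj Γ) k.form (γ x) = pushforwardAt E (proj Γ) k.form x ↔
        pullback (E := E) γ k.form x = (1 : ℝ) • k.form x := by
    have hiff := pushforwardAt_eq_smul_iff (isInvertible_diffAt (isLocalDiffeomorph_proj Γ x))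
      (T := pullback (E := E) γ k.form) (S := k.form) (c := 1)
    rw [← pushforwardAt_proj_apply hγ, one_smul] at hiff
    exact hiff
  refine ⟨fun hk γ hγ => ⟨one_pos, fun x => ?_⟩, fun hk x y hxy => ?_⟩
  · exact (h γ hγ x).1 (hk _ _ (congrFun (proj_comp hγ) x))
  · obtain ⟨γ, hγ, rfl⟩ := proj_eq_iff.1 hxy
    exact ((h γ hγ x).2 ((hk γ hγ).2 x)).symm

end Quotient

end LCK

end

theorem mainTheorem9_general {E : Type*} [NormedAddCommGroup E] [NormedSpace ℂ E]
    [FiniteDimensional ℂ E] {M : Type*} [TopologicalSpace M] [T2Space M]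
    [SecondCountableTopology M] [ChartedSpace E M] [IsManifold 𝓘(ℂ, E) ω M]
    (gt : HermitianMetric E M) (hgt : gt.IsLCK)
    (Γ : Subgroup (Biholomorphism E M)) (hΓ : ∀ γ ∈ Γ, gt.IsAutomorphism γ)
    [IsCancelSMul Γ M] [ProperlyDiscontinuousSMul Γ M] :
    (T2Space (MulAction.orbitRel.Quotient Γ M) ∧
      SecondCountableTopology (MulAction.orbitRel.Quotient Γ M) ∧
      IsLocalDiffeomorph 𝓘(ℂ, E) 𝓘(ℂ, E) ω (proj Γ)) ∧
    ∃ g : HermitianMetric E (MulAction.orbitRel.Quotient Γ M),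
      g.IsLCK ∧ ConformalTo (pullback (proj Γ) g.form) gt.form ∧
      (∀ g' : HermitianMetric E (MulAction.orbitRel.Quotient Γ M),
        ConformalTo (pullback (proj Γ) g'.form) gt.form → ConformalTo g.form g'.form) ∧
      ∀ k : HermitianMetric E M, k.IsKahler → ConformalTo gt.form k.form →
        ((∀ γ ∈ Γ, k.HasDilationFactor γ 1) → g.IsGCK) ∧
        (2 ≤ Module.finrank ℂ E → PreconnectedSpace M → g.IsGCK →
          ∀ γ ∈ Γ, k.HasDilationFactor γ 1) := by
  have : ProperSpace E := FiniteDimensional.proper ℂ E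
  have : LocallyCompactSpace M := ChartedSpace.locallyCompactSpace E M
  have : SecondCountableTopology (MulAction.orbitRel.Quotient Γ M) :=
    ContinuousConstSMul.secondCountableTopology
  have : LocallyCompactSpace (MulAction.orbitRel.Quotient Γ M) :=
    ChartedSpace.locallyCompactSpace E _
  have hproj := isLocalDiffeomorph_proj Γ
  have hsurj := proj_surjective Γ
  obtain ⟨g, hg⟩ := exists_conformalTo_pullback hproj hsurj (fiberConformal_proj hΓ)
  refine ⟨⟨inferInstance, inferInstance, hproj⟩, g, ?_, hg,
    fun g' hg' => .of_pullback hproj hsurj (hg.trans hg'.symm), fun k hk hgk => ⟨fun h => ?_,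
    fun hE _ hgGCK => ?_⟩⟩
  · exact .of_pullback hproj hsurj (hgt.of_conformalTo (k := g.pullback _ hproj) hg.symm)
  · exact isGCK_of_fiberInvariant hproj hsurj hk (hg.trans hgk) (fiberInvariant_proj_iff.2 h)
  · exact fiberInvariant_proj_iff.1
      (fiberInvariant_of_isGCK hE hproj hsurj hk (hg.trans hgk) hgGCK)

theorem mainTheorem9 {E : Type*} [NormedAddCommGroup E] [NormedSpace ℂ E] [FiniteDimensional ℂ E]
    (hE : 2 ≤ Module.finrank ℂ E)
    {M : Type*} [TopologicalSpace M] [T2Space M] [SecondCountableTopology M]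
    [ChartedSpace E M] [IsManifold 𝓘(ℂ, E) ω M]
    (gt : HermitianMetric E M) (hgt : gt.IsGCK)
    (Γ : Subgroup (Biholomorphism E M)) (hΓ : ∀ γ ∈ Γ, gt.IsAutomorphism γ)
    [IsCancelSMul Γ M] [ProperlyDiscontinuousSMul Γ M] :
    (T2Space (MulAction.orbitRel.Quotient Γ M) ∧
      SecondCountableTopology (MulAction.orbitRel.Quotient Γ M) ∧
      IsLocalDiffeomorph 𝓘(ℂ, E) 𝓘(ℂ, E) ω (proj Γ)) ∧
    ∃ g : HermitianMetric E (MulAction.orbitRel.Quotient Γ M),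
      g.IsLCK ∧ ConformalTo (pullback (proj Γ) g.form) gt.form ∧
      (∀ g' : HermitianMetric E (MulAction.orbitRel.Quotient Γ M),
        ConformalTo (pullback (proj Γ) g'.form) gt.form → ConformalTo g.form g'.form) ∧
      (ConnectedSpace M →
        ∀ k : HermitianMetric E M, k.IsKahler → ConformalTo gt.form k.form →
          (∀ γ ∈ Γ, k.IsHomothety γ) →
          (g.IsGCK ↔ ∀ γ ∈ Γ, k.dilationFactor γ = 1)) := by
  have : Nontrivial E := Module.nontrivial_of_finrank_pos (R := ℂ) (by omega)
  obtain ⟨hquot, g, hg, hconf, huniq, hk_iff⟩ := mainTheorem9_general gt hgt.isLCK Γ hΓ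
  refine ⟨hquot, g, hg, hconf, huniq, fun _ k hk hgk hhom => ?_⟩
  rw [forall₂_congr fun γ hγ => (hhom γ hγ).dilationFactor_eq_one_iff]
  exact ⟨(hk_iff k hk hgk).2 hE inferInstance, (hk_iff k hk hgk).1⟩
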